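/- Let $m\ge 0$ and let $a=(a_1,\dots,a_{2m})\in\mathbb R^{2m}$ have pairwise distinct entries such that $a_{2k-1}<a_{2k}$ for $k=1,\dots,m$ and the intervals $(a_{2k-1},a_{2k})$ are pairwise disjoint; put $I=I(a)=\bigcup_{k=1}^m(a_{2k-1},a_{2k})$. Let $\lambda\in\mathbb C$, fix a square root $\sqrt\lambda$, and set $$K(x,y)=\frac{\sin\pi(x-y)}{\pi(x-y)}\quad(K(x,x)=1),\qquad A(x)=\frac{\sqrt\lambda}{\pi}\sin\pi x,\qquad A'(x)=\sqrt\lambda\cos\pi x .$$ Let $K=K_a$ be the integral operator with kernel $\lambda K(x,y)\chi_I(y)$, acting on the bounded continuous functions $\mathbb R\to\mathbb C$, and let $$D(a)=\det(1-K)=\sum_{n\ge0}\frac{(-1)^n}{n!}\int_{\mathbb R^n}\det\bigl(\lambda K(x_i,x_j)\chi_I(x_j)\bigr)_{i,j=1}^n\,dx$$ be its Fredholm determinant. Assume $D(a)\neq0$. Then $1-K$ is invertible; put $Q=(1-K)^{-1}A$ and $P=(1-K)^{-1}A'$, and let $R(x,y)=\bigl((1-K)^{-1}[\lambda K(\cdot,y)\chi_I(y)]\bigr)(x)$.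 Then $R(x,y)$ is the kernel of the operator $(1-K)^{-1}K$, and the boundary values $$q_j=\lim_{x\to a_j,\,x\in I}Q(x),\qquad p_j=\lim_{x\to a_j,\,x\in I}P(x),\qquad R(a_j,a_k)=\lim_{x\to a_j,\ y\to a_k,\ x,y\in I}R(x,y)$$ exist for $1\le j,k\le 2m$. As functions of $a$ they satisfy the equations of Jimbo, Miwa, Môri and Sato: for $j\ne k$, $$R(a_j,a_k)=\frac{q_jp_k-p_jq_k}{a_j-a_k},\qquad \frac{\partial q_j}{\partial a_k}=(-1)^kR(a_j,a_k)\,q_k,\qquad \frac{\partial p_j}{\partial a_k}=(-1)^kR(a_j,a_k)\,p_k,$$ and for every $j$, $$R(a_j,a_j)=\pi^2q_j^2+p_j^2+\sum_{k}(-1)^kR(a_j,a_k)R(a_k,a_j)(a_j-a_k),$$ $$\frac{\partial q_j}{\partial a_j}=p_j-\sum_{k\ne j}(-1)^kR(a_j,a_k)\,q_k,\qquad \frac{\partial p_j}{\partial a_j}=-\pi^2q_j-\sum_{k\neq j}(-1)^kR(a_j,a_k)\,p_k ,$$ where in particular these partial derivatives exist. Moreover, near $a$ there is a differentiable branch of $\log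 D$, and throughout a neighbourhood of $a$ $$d_a\log\det(1-K)=-\sum_{j=1}^{2m}(-1)^jR(a_j,a_j)\,da_j .$$ -/

import Mathlib

open MeasureTheory Filter Topology Set
open scoped BoundedContinuousFunction

noncomputable section

namespace JMMS

/-- The sine kernel `sin (π (x - y)) / (π (x - y))`, with its limiting value `1` at `x = y`. -/
def sineKernel (x y : ℝ) : ℝ := Real.sinc (Real.pi * (x - y))

/-- The left endpoint of the `k`-th interval, `k = 0, …, m - 1`. -/
def leftEnd {m : ℕ} (a : Fin (2 * m) → ℝ) (k : Fin m) : ℝ := a ⟨2 * k.1, by omega⟩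

/-- The right endpoint of the `k`-th interval, `k = 0, …, m - 1`. -/
def rightEnd {m : ℕ} (a : Fin (2 * m) → ℝ) (k : Fin m) : ℝ := a ⟨2 * k.1 + 1, by omega⟩

/-- The `k`-th open interval. -/
def interval {m : ℕ} (a : Fin (2 * m) → ℝ) (k : Fin m) : Set ℝ :=
  Ioo (leftEnd a k) (rightEnd a k)

/-- The union `I` of the open intervals. -/
def intervals {m : ℕ} (a : Fin (2 * m) → ℝ) : Set ℝ := ⋃ k : Fin m, interval a k

/-- The `m`-tuples of intervals under consideration: the intervals are non-empty and disjoint,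
and the `2 m` endpoints are distinct. -/
structure Admissible {m : ℕ} (a : Fin (2 * m) → ℝ) : Prop where
  lt : ∀ k : Fin m, leftEnd a k < rightEnd a k
  disjoint : Pairwise fun k l : Fin m => Disjoint (interval a k) (interval a l)
  injective : Function.Injective a

/-- The sign of the endpoint `a j`: `-1` at left endpoints, `+1` at right endpoints. The index `j`
starts at `0`; numbered from `1`, as is usual, this is the sign `(-1) ^ j`. -/
def sgn {m : ℕ} (j : Fin (2 * m)) : ℂ := (-1) ^ (j.1 + 1)

/-- The kernel `λ K(x, y) χ_I(y)`. -/
def kernel {m : ℕ} (lam : ℂ) (a : Fin (2 * m) → ℝ) (x y : ℝ) : ℂ :=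
  (intervals a).indicator (fun y => lam * (sineKernel x y : ℂ)) y

theorem measurableSet_intervals {m : ℕ} (a : Fin (2 * m) → ℝ) : MeasurableSet (intervals a) :=
  MeasurableSet.iUnion fun _ => measurableSet_Ioo

theorem volume_intervals_lt_top {m : ℕ} (a : Fin (2 * m) → ℝ) :
    volume (intervals a) < ⊤ := by
  refine (measure_iUnion_le _).trans_lt ?_
  rw [tsum_fintype]
  exact ENNReal.sum_lt_top.2 fun k _ => measure_Ioo_lt_top

theorem continuous_sineKernel : Continuous fun z : ℝ × ℝ => sineKernel z.1 z.2 := by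
  unfold sineKernel
  exact Real.continuous_sinc.comp (by fun_prop)

theorem abs_sineKernel_le_one (x y : ℝ) : |sineKernel x y| ≤ 1 := Real.abs_sinc_le_one _

theorem continuous_kernel_left {m : ℕ} (lam : ℂ) (a : Fin (2 * m) → ℝ) (y : ℝ) :
    Continuous fun x => kernel lam a x y := by
  by_cases hy : y ∈ intervals a
  · simp only [kernel, indicator_of_mem hy]
    exact continuous_const.mul (Complex.continuous_ofReal.comp
      (continuous_sineKernel.comp (by fun_prop : Continuous fun x : ℝ => (x, y))))
  · simp only [kernel, indicator_of_notMem hy]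
    exact continuous_const

theorem norm_kernel_le {m : ℕ} (lam : ℂ) (a : Fin (2 * m) → ℝ) (x y : ℝ) :
    ‖kernel lam a x y‖ ≤ (intervals a).indicator (fun _ => ‖lam‖) y := by
  by_cases hy : y ∈ intervals a
  · simp only [kernel, indicator_of_mem hy, norm_mul, Complex.norm_real, Real.norm_eq_abs]
    exact mul_le_of_le_one_right (norm_nonneg _) (abs_sineKernel_le_one x y)
  · simp [kernel, indicator_of_notMem hy]

theorem measurable_kernel_right {m : ℕ} (lam : ℂ) (a : Fin (2 * m) → ℝ) (x : ℝ) :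
    Measurable fun y => kernel lam a x y := by
  refine Measurable.indicator ?_ (measurableSet_intervals a)
  exact (continuous_const.mul (Complex.continuous_ofReal.comp
    (continuous_sineKernel.comp (by fun_prop : Continuous fun y : ℝ => (x, y))))).measurable

theorem integrable_bound {m : ℕ} (lam : ℂ) (a : Fin (2 * m) → ℝ) (C : ℝ) :
    Integrable fun y => (intervals a).indicator (fun _ => ‖lam‖) y * C := by
  refine Integrable.mul_const ?_ C
  rw [integrable_indicator_iff (measurableSet_intervals a)]
  exact integrableOn_const (volume_intervals_lt_top a).ne

theorem norm_integrand_le {m : ℕ} (lam : ℂ) (a : Fin (2 * m) → ℝ) (f : ℝ →ᵇ ℂ) (x y : ℝ) :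
    ‖kernel lam a x y * f y‖ ≤ (intervals a).indicator (fun _ => ‖lam‖) y * ‖f‖ := by
  rw [norm_mul]
  exact mul_le_mul (norm_kernel_le lam a x y) (f.norm_coe_le_norm y) (norm_nonneg _)
    ((norm_nonneg _).trans (norm_kernel_le lam a x y))

theorem integrable_integrand {m : ℕ} (lam : ℂ) (a : Fin (2 * m) → ℝ) (f : ℝ →ᵇ ℂ) (x : ℝ) :
    Integrable fun y => kernel lam a x y * f y :=
  (integrable_bound lam a ‖f‖).mono'
    ((measurable_kernel_right lam a x).mul f.continuous.measurable).aestronglyMeasurable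
    (Eventually.of_forall fun y => norm_integrand_le lam a f x y)

theorem norm_integral_le {m : ℕ} (lam : ℂ) (a : Fin (2 * m) → ℝ) (f : ℝ →ᵇ ℂ) (x : ℝ) :
    ‖∫ y, kernel lam a x y * f y‖ ≤
      (∫ y, (intervals a).indicator (fun _ => ‖lam‖) y) * ‖f‖ := by
  rw [← integral_mul_const]
  exact norm_integral_le_of_norm_le (integrable_bound lam a ‖f‖)
    (Eventually.of_forall fun y => norm_integrand_le lam a f x y)

/-- The function `K f`, that is `x ↦ ∫ λ K(x, y) χ_I(y) f(y) dy`. -/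
def sineOpFun {m : ℕ} (lam : ℂ) (a : Fin (2 * m) → ℝ) (f : ℝ →ᵇ ℂ) : ℝ →ᵇ ℂ :=
  BoundedContinuousFunction.ofNormedAddCommGroup (fun x => ∫ y, kernel lam a x y * f y)
    (continuous_of_dominated
      (fun x => (integrable_integrand lam a f x).aestronglyMeasurable)
      (fun x => Eventually.of_forall fun y => norm_integrand_le lam a f x y)
      (integrable_bound lam a ‖f‖)
      (Eventually.of_forall fun y => (continuous_kernel_left lam a y).mul continuous_const))
    ((∫ y, (intervals a).indicator (fun _ => ‖lam‖) y) * ‖f‖)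
    (norm_integral_le lam a f)

/-- The integral operator `K` with kernel `λ K(x, y) χ_I(y)`, as a bounded operator on the space of
bounded continuous functions on `ℝ` (which contains `A`, `A'` and the columns of the kernel). -/
def sineOp {m : ℕ} (lam : ℂ) (a : Fin (2 * m) → ℝ) : (ℝ →ᵇ ℂ) →L[ℂ] (ℝ →ᵇ ℂ) :=
  LinearMap.mkContinuous
    { toFun := sineOpFun lam a
      map_add' := fun f g => by
        ext x
        have h := integral_add (integrable_integrand lam a f x) (integrable_integrand lam a g x)
        simpa [sineOpFun, mul_add] using h
      map_smul' := fun c f => by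
        ext x
        have h := integral_const_mul (μ := volume) c (fun y => kernel lam a x y * f y)
        simpa [sineOpFun, mul_left_comm] using h }
    (∫ y, (intervals a).indicator (fun _ => ‖lam‖) y)
    (fun f => by
      refine (BoundedContinuousFunction.norm_le ?_).2 (norm_integral_le lam a f)
      exact mul_nonneg
        (integral_nonneg fun y => indicator_nonneg (fun _ _ => norm_nonneg lam) y) (norm_nonneg f))

theorem sineOp_apply {m : ℕ} (lam : ℂ) (a : Fin (2 * m) → ℝ) (f : ℝ →ᵇ ℂ) (x : ℝ) :
    sineOp lam a f x = ∫ y, kernel lam a x y * f y := rfl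

/-- The operator `(1 - K)⁻¹` (equal to `0` by convention if `1 - K` is not invertible). -/
def invOp {m : ℕ} (lam : ℂ) (a : Fin (2 * m) → ℝ) : (ℝ →ᵇ ℂ) →L[ℂ] (ℝ →ᵇ ℂ) :=
  Ring.inverse (1 - sineOp lam a)

/-- The Fredholm determinant `det (1 - K)`, given by its Fredholm expansion. -/
def fredholmDet {m : ℕ} (lam : ℂ) (a : Fin (2 * m) → ℝ) : ℂ :=
  ∑' n : ℕ, (-1 : ℂ) ^ n / (n.factorial : ℂ) *
    ∫ x : Fin n → ℝ, Matrix.det (Matrix.of fun i j : Fin n => kernel lam a (x i) (x j))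

/-- The function `A(x) = √λ sin (π x) / π`, with `s = √λ`. -/
def funA (s : ℂ) : ℝ →ᵇ ℂ :=
  BoundedContinuousFunction.ofNormedAddCommGroup
    (fun x : ℝ => s * ((Real.sin (Real.pi * x) / Real.pi : ℝ) : ℂ))
    (continuous_const.mul (Complex.continuous_ofReal.comp (by fun_prop))) (‖s‖ * (1 / Real.pi))
    (fun x => by
      rw [norm_mul, Complex.norm_real, Real.norm_eq_abs, abs_div, abs_of_pos Real.pi_pos]
      gcongr
      exact Real.abs_sin_le_one _)

/-- The derivative `A'(x) = √λ cos (π x)` of `A`, with `s = √λ`. -/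
def funA' (s : ℂ) : ℝ →ᵇ ℂ :=
  BoundedContinuousFunction.ofNormedAddCommGroup
    (fun x : ℝ => s * ((Real.cos (Real.pi * x) : ℝ) : ℂ))
    (continuous_const.mul (Complex.continuous_ofReal.comp (by fun_prop))) (‖s‖ * 1)
    (fun x => by
      rw [norm_mul, Complex.norm_real, Real.norm_eq_abs]
      gcongr
      exact Real.abs_cos_le_one _)

theorem hasDerivAt_funA (s : ℂ) (x : ℝ) : HasDerivAt (funA s) (funA' s x) x := by
  have h1 : HasDerivAt (fun x : ℝ => Real.sin (Real.pi * x) / Real.pi)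
      (Real.cos (Real.pi * x)) x := by
    have h := (((hasDerivAt_id x).const_mul Real.pi).sin).div_const Real.pi
    have e : Real.cos (Real.pi * id x) * (Real.pi * 1) / Real.pi = Real.cos (Real.pi * x) := by
      rw [mul_one, mul_div_assoc, div_self Real.pi_ne_zero, mul_one]; rfl
    rw [e] at h
    exact h
  exact (h1.ofReal_comp).const_mul s

/-- The function `Q = (1 - K)⁻¹ A`. -/
def funQ {m : ℕ} (lam s : ℂ) (a : Fin (2 * m) → ℝ) : ℝ →ᵇ ℂ := invOp lam a (funA s)

/-- The function `P = (1 - K)⁻¹ A'`. -/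
def funP {m : ℕ} (lam s : ℂ) (a : Fin (2 * m) → ℝ) : ℝ →ᵇ ℂ := invOp lam a (funA' s)

/-- The column `x ↦ λ K(x, y) χ_I(y)` of the kernel. -/
def kernelColumn {m : ℕ} (lam : ℂ) (a : Fin (2 * m) → ℝ) (y : ℝ) : ℝ →ᵇ ℂ :=
  BoundedContinuousFunction.ofNormedAddCommGroup (fun x => kernel lam a x y)
    (continuous_kernel_left lam a y) ((intervals a).indicator (fun _ => ‖lam‖) y)
    (fun x => norm_kernel_le lam a x y)

/-- The resolvent kernel `R(x, y)`, the kernel of `(1 - K)⁻¹ K`: its column at `y` is `(1 - K)⁻¹`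
applied to the column at `y` of the kernel of `K`. -/
def resolventKernel {m : ℕ} (lam : ℂ) (a : Fin (2 * m) → ℝ) (x y : ℝ) : ℂ :=
  invOp lam a (kernelColumn lam a y) x

/-- The boundary value `q j`, the limit of `Q x` as `x → a j` with `x ∈ I`. -/
def qAt {m : ℕ} (lam s : ℂ) (a : Fin (2 * m) → ℝ) (j : Fin (2 * m)) : ℂ :=
  limUnder (𝓝[intervals a] (a j)) fun x => funQ lam s a x

/-- The boundary value `p j`, the limit of `P x` as `x → a j` with `x ∈ I`. -/
def pAt {m : ℕ} (lam s : ℂ) (a : Fin (2 * m) → ℝ) (j : Fin (2 * m)) : ℂ :=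
  limUnder (𝓝[intervals a] (a j)) fun x => funP lam s a x

/-- The boundary value `R(a j, a k)`, the limit of `R(x, y)` as `x → a j`, `y → a k` with
`x, y ∈ I`. -/
def rAt {m : ℕ} (lam : ℂ) (a : Fin (2 * m) → ℝ) (j k : Fin (2 * m)) : ℂ :=
  limUnder (𝓝[intervals a] (a j) ×ˢ 𝓝[intervals a] (a k))
    fun z : ℝ × ℝ => resolventKernel lam a z.1 z.2

/-- The 1-form `- ∑ j, (-1) ^ j R(a j, a j) d(a j)` at the point `a`. -/
def omegaForm {m : ℕ} (lam : ℂ) (a : Fin (2 * m) → ℝ) : (Fin (2 * m) → ℝ) →L[ℝ] ℂ :=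
  -∑ j : Fin (2 * m), (ContinuousLinearMap.proj (R := ℝ) (φ := fun _ : Fin (2 * m) => ℝ) j).smulRight
    (sgn j * rAt lam a j j)

end JMMS

end

/-! The proof is Fredholm's theory followed by calculus on the resolvent. Hadamard's inequality
makes the series `weightedDet` (D) and `weightedMinor` (N) converge for every integrable weight.
Expanding a bordered determinant along its first row gives the identity N = D K + K w N of
`weightedMinor_eq`. Together with the symmetry of N it shows that 1 - K is invertible when D ≠ 0 and
that the resolvent kernel is λN/D (`resolvent_eq`). The latter is symmetric and continuous on the
whole plane, so the boundary values are plain values at the endpoints.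

Three facts give the differential equations. First, K_b g is the integral of λ g(y) K(·, y) over
I(b), differentiable in b by the fundamental theorem of calculus. With g = (1 - K_a)⁻¹ f, the
identity (1 - K_b)⁻¹ f = g + (1 - K_b)⁻¹ (K_b - K_a) g then yields ∂_k (1 - K)⁻¹ f = (-1)^k R(·,
a_k) g(a_k) (`hasFDerivAt_invOp`). Second, the sine kernel depends only on x - y and the span of A
and A' is invariant under translations, so moving the argument amounts to moving all endpoints the
other way (`hasDerivAt_invOp_along`). Third, λ(x - y)K(x, y) = A(x)A'(y) - A'(x)A(y), a form which
the resolvent inherits with Q and P in place of A and A' (`sub_mul_resolvent`); its derivative at x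
= y is the formula on the diagonal.

For the determinant, D is a differentiable function of the weight in L¹, with derivative h ↦ -∫ h(y)
N(y, y) dy. The weight λχ_I is merely Lipschitz in the endpoints, but this derivative evaluated on
it is an integral of a continuous function over I, which is differentiable;
`hasFDerivAt_comp_of_lipschitz` shows that this suffices. Division by D turns λN(a_j, a_j) into
R(a_j, a_j). -/

noncomputable section

namespace JMMS

/-! ### Determinants of the sine kernel and Hadamard's bound -/

/-- **Hadamard's inequality** for a real matrix whose entries are bounded by `1`. -/
theorem abs_det_le_of_abs_entry_le_one {n : ℕ} (A : Matrix (Fin n) (Fin n) ℝ)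
    (hA : ∀ i j, |A i j| ≤ 1) : |A.det| ≤ √(n : ℝ) ^ n := by
  have : Fact (Module.finrank ℝ (EuclideanSpace ℝ (Fin n)) = n) := ⟨by simp⟩
  let b := EuclideanSpace.basisFun (Fin n) ℝ
  let v : Fin n → EuclideanSpace ℝ (Fin n) := fun j => WithLp.toLp 2 fun i => A i j
  -- The volume of the parallelepiped spanned by the columns is at most the product of their
  -- lengths, each of which is at most √n.
  have h1 := b.toBasis.orientation.abs_volumeForm_apply_le v
  rw [Orientation.volumeForm_robust' _ b, Module.Basis.det_apply] at h1
  have h2 : b.toBasis.toMatrix v = A := by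
    ext i j
    simp [Module.Basis.toMatrix_apply, b, v]
  rw [h2] at h1
  refine h1.trans ?_
  have h3 : ∀ j ∈ Finset.univ, ‖v j‖ ≤ √(n : ℝ) := by
    intro j _
    rw [EuclideanSpace.norm_eq]
    refine Real.sqrt_le_sqrt ?_
    calc ∑ i, ‖v j i‖ ^ 2 ≤ ∑ _i : Fin n, (1 : ℝ) :=
          Finset.sum_le_sum fun i _ => pow_le_one₀ (norm_nonneg _) (hA i j)
      _ = n := by simp
  simpa using Finset.prod_le_prod (fun j _ => norm_nonneg (v j)) h3

/-- The determinant of the matrix `sineKernel (u i) (v j)`. -/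
def kerDet {n : ℕ} (u v : Fin n → ℝ) : ℝ := (Matrix.of fun i j => sineKernel (u i) (v j)).det

theorem abs_kerDet_le {n : ℕ} (u v : Fin n → ℝ) : |kerDet u v| ≤ √(n : ℝ) ^ n :=
  abs_det_le_of_abs_entry_le_one _ fun i j => abs_sineKernel_le_one (u i) (v j)

theorem norm_kerDet_le {n : ℕ} (u v : Fin n → ℝ) : ‖(kerDet u v : ℂ)‖ ≤ √(n : ℝ) ^ n := by
  rw [Complex.norm_real]
  exact abs_kerDet_le u v

theorem continuous_kerDet {X : Type*} [TopologicalSpace X] {n : ℕ} {u v : X → Fin n → ℝ}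
    (hu : Continuous u) (hv : Continuous v) : Continuous fun x => kerDet (u x) (v x) := by
  refine Continuous.matrix_det (continuous_matrix fun i j => ?_)
  exact continuous_sineKernel.comp
    (((continuous_apply i).comp hu).prodMk ((continuous_apply j).comp hv))

theorem sineKernel_comm (x y : ℝ) : sineKernel x y = sineKernel y x := by
  unfold sineKernel
  rw [← Real.sinc_neg]
  congr 1
  ring

theorem kerDet_comm {n : ℕ} (u v : Fin n → ℝ) : kerDet u v = kerDet v u := by
  unfold kerDet
  rw [← Matrix.det_transpose]
  congr 1
  ext i j
  exact sineKernel_comm _ _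

theorem kerDet_comp_perm {n : ℕ} (σ : Equiv.Perm (Fin n)) (u v : Fin n → ℝ) :
    kerDet (u ∘ σ) (v ∘ σ) = kerDet u v :=
  Matrix.det_submatrix_equiv_self σ (Matrix.of fun i j => sineKernel (u i) (v j))

theorem kerDet_perm_left {n : ℕ} (σ : Equiv.Perm (Fin n)) (u v : Fin n → ℝ) :
    kerDet (u ∘ σ) v = (Equiv.Perm.sign σ : ℤ) * kerDet u v :=
  Matrix.det_permute σ (Matrix.of fun i j => sineKernel (u i) (v j))

/-- Moving a point from position `k` to the front is a cycle of sign (-1)^k. Applied to rows and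
columns at once it leaves the determinant unchanged; applied to the rows alone it supplies the sign
of a cofactor. -/
theorem cons_eq_insertNth_comp {n : ℕ} (k : Fin (n + 1)) (y : ℝ) (X : Fin n → ℝ) :
    Fin.cons y X = (k.insertNth y X : Fin (n + 1) → ℝ) ∘ k.cycleRange.symm := by
  funext j
  exact (Fin.insertNth_apply_cycleRange_symm k y X j).symm

theorem kerDet_insertNth_self {n : ℕ} (k : Fin (n + 1)) (y : ℝ) (X : Fin n → ℝ) :
    kerDet (k.insertNth y X) (k.insertNth y X) =
      kerDet (Fin.cons y X : Fin (n + 1) → ℝ) (Fin.cons y X : Fin (n + 1) → ℝ) := by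
  rw [cons_eq_insertNth_comp k y X, kerDet_comp_perm]

/-- Expansion of a bordered kernel determinant along its first row. -/
theorem kerDet_cons_insert {n : ℕ} (x y : ℝ) (X : Fin (n + 1) → ℝ) :
    kerDet (Fin.cons x X : Fin (n + 2) → ℝ) (Fin.cons y X : Fin (n + 2) → ℝ) =
      sineKernel x y * kerDet X X - ∑ k : Fin (n + 1), sineKernel x (X k) *
        kerDet (Fin.cons (X k) (k.removeNth X) : Fin (n + 1) → ℝ)
          (Fin.cons y (k.removeNth X) : Fin (n + 1) → ℝ) := by
  have key : ∀ k : Fin (n + 1), (-1 : ℝ) ^ (k.succ : ℕ) * sineKernel x (X k) *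
      kerDet X ((Fin.cons y X : Fin (n + 2) → ℝ) ∘ k.succ.succAbove) =
      -(sineKernel x (X k) * kerDet (Fin.cons (X k) (k.removeNth X) : Fin (n + 1) → ℝ)
          (Fin.cons y (k.removeNth X) : Fin (n + 1) → ℝ)) := by
    intro k
    have h1 : ((Fin.cons y X : Fin (n + 2) → ℝ) ∘ k.succ.succAbove) =
        (Fin.cons y (k.removeNth X) : Fin (n + 1) → ℝ) := by
      funext j
      refine Fin.cases ?_ (fun i => ?_) j
      · simp
      · simp [Fin.removeNth]
    -- The cycle that brings `X k` to the front has sign (-1)^k, which against the cofactor sign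
    -- (-1)^(k+1) leaves a uniform minus sign.
    have h2 : kerDet (Fin.cons (X k) (k.removeNth X) : Fin (n + 1) → ℝ)
          (Fin.cons y (k.removeNth X) : Fin (n + 1) → ℝ) =
        (-1) ^ (k : ℕ) * kerDet X (Fin.cons y (k.removeNth X) : Fin (n + 1) → ℝ) := by
      rw [cons_eq_insertNth_comp k (X k), Fin.insertNth_self_removeNth, kerDet_perm_left]
      simp [Equiv.Perm.sign_symm, Fin.sign_cycleRange]
    rw [h1, h2, Fin.val_succ, pow_succ]
    ring
  have h0 : kerDet (Fin.cons x X : Fin (n + 2) → ℝ) (Fin.cons y X : Fin (n + 2) → ℝ) =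
      ∑ j : Fin (n + 2), (-1 : ℝ) ^ (j : ℕ) *
        sineKernel x ((Fin.cons y X : Fin (n + 2) → ℝ) j) *
        kerDet X ((Fin.cons y X : Fin (n + 2) → ℝ) ∘ j.succAbove) := by
    unfold kerDet
    rw [Matrix.det_succ_row_zero]
    rfl
  rw [h0, Fin.sum_univ_succ]
  simp only [Fin.cons_succ, key, Finset.sum_neg_distrib, sub_eq_add_neg]
  congr 1
  simp only [Fin.val_zero, pow_zero, Fin.cons_zero, one_mul]
  rfl

/-- By AM-GM, T = (T 2ⁿ)(2⁻ⁿ) ≤ (T 2ⁿ)² + 4⁻ⁿ, and squaring removes the square root: T² is (n+1) ·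
(n+1)^(n+1)/(n+1)! · r^(2n)/n!. The bounds n + 1 ≤ 2ⁿ and x^k/k! ≤ eˣ then give an exponential
series, where 8 = 2 · 4 collects the 2ⁿ from n + 1 and the 4ⁿ from AM-GM. -/
theorem summable_hadamard {r : ℝ} (hr : 0 ≤ r) :
    Summable fun n : ℕ => √((n + 1 : ℕ) : ℝ) ^ (n + 1) / (n.factorial : ℝ) * r ^ n := by
  have hs : Summable fun n : ℕ => Real.exp 1 * ((8 * Real.exp 1 * r ^ 2) ^ n / (n.factorial : ℝ)) +
      (1 / 4 : ℝ) ^ n :=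
    ((Real.summable_pow_div_factorial _).mul_left _).add
      (summable_geometric_of_lt_one (by norm_num) (by norm_num))
  refine Summable.of_nonneg_of_le (fun n => by positivity) (fun n => ?_) hs
  have hf : (0 : ℝ) < n.factorial := by positivity
  set T := √((n + 1 : ℕ) : ℝ) ^ (n + 1) / (n.factorial : ℝ) * r ^ n with hT
  have hTpos : 0 ≤ T := by positivity
  have h1 : T ^ 2 = ((n + 1 : ℕ) : ℝ) * (((n + 1 : ℕ) : ℝ) ^ (n + 1) / ((n + 1).factorial : ℝ)) *
      ((r ^ 2) ^ n / n.factorial) := by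
    have e : (√((n + 1 : ℕ) : ℝ) ^ (n + 1)) ^ 2 = ((n + 1 : ℕ) : ℝ) ^ (n + 1) := by
      rw [← pow_mul, mul_comm, pow_mul, Real.sq_sqrt (by positivity)]
    rw [hT, mul_pow, div_pow, e, Nat.factorial_succ, ← pow_mul, ← pow_mul, mul_comm n 2]
    push_cast
    field_simp
  have h2 : ((n + 1 : ℕ) : ℝ) ≤ 2 ^ n := by exact_mod_cast Nat.lt_two_pow_self
  have h3 : ((n + 1 : ℕ) : ℝ) ^ (n + 1) / ((n + 1).factorial : ℝ) ≤ Real.exp 1 ^ (n + 1) := by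
    rw [← Real.exp_nat_mul, mul_one]
    exact Real.pow_div_factorial_le_exp _ (by positivity) _
  have h4 : T ^ 2 * 4 ^ n ≤ Real.exp 1 * ((8 * Real.exp 1 * r ^ 2) ^ n / (n.factorial : ℝ)) := by
    calc T ^ 2 * 4 ^ n ≤ 2 ^ n * Real.exp 1 ^ (n + 1) * ((r ^ 2) ^ n / n.factorial) * 4 ^ n := by
          rw [h1]; gcongr
      _ = _ := by
          rw [show (8 : ℝ) * Real.exp 1 * r ^ 2 = 2 * 4 * Real.exp 1 * r ^ 2 by norm_num,
            mul_pow, mul_pow, mul_pow, pow_succ]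
          ring
  have h5 : (2 : ℝ) ^ n * (1 / 2) ^ n = 1 := by rw [← mul_pow]; norm_num
  have h6 : (4 : ℝ) ^ n = (2 ^ n) ^ 2 := by rw [← pow_mul, mul_comm n 2, pow_mul]; norm_num
  have h7 : (1 / 4 : ℝ) ^ n = ((1 / 2) ^ n) ^ 2 := by
    rw [← pow_mul, mul_comm n 2, pow_mul]; norm_num
  rw [h6] at h4
  rw [h7]
  have h8 : T = (T * 2 ^ n) * (1 / 2) ^ n := by rw [mul_assoc, h5, mul_one]
  nlinarith [sq_nonneg (T * 2 ^ n - (1 / 2) ^ n), sq_nonneg (T * 2 ^ n),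
    sq_nonneg ((1 / 2 : ℝ) ^ n)]

/-! ### Fredholm's series for an integrable weight -/

theorem integrable_mul_prod {n : ℕ} {w : Fin n → ℝ → ℂ} (hw : ∀ i, Integrable (w i))
    {F : (Fin n → ℝ) → ℂ} (hF : Continuous F) {C : ℝ} (hC : ∀ X, ‖F X‖ ≤ C) :
    Integrable fun X : Fin n → ℝ => F X * ∏ i, w i (X i) :=
  (Integrable.fintype_prod hw).bdd_mul hF.aestronglyMeasurable (Eventually.of_forall hC)

theorem norm_integral_mul_prod_le {n : ℕ} {w : Fin n → ℝ → ℂ} (hw : ∀ i, Integrable (w i))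
    {F : (Fin n → ℝ) → ℂ} {C : ℝ} (hC : ∀ X, ‖F X‖ ≤ C) :
    ‖∫ X : Fin n → ℝ, F X * ∏ i, w i (X i)‖ ≤ C * ∏ i, ∫ y, ‖w i y‖ := by
  rw [← integral_fintype_prod_volume_eq_prod, ← integral_const_mul]
  refine norm_integral_le_of_norm_le
    ((Integrable.fintype_prod fun i => (hw i).norm).const_mul C)
    (Eventually.of_forall fun X => ?_)
  rw [norm_mul, norm_prod]
  exact mul_le_mul_of_nonneg_right (hC X) (Finset.prod_nonneg fun i _ => norm_nonneg _)

/-- Fubini's theorem for the separation of the `k`-th coordinate. -/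
theorem integral_eq_integral_insertNth {n : ℕ} (k : Fin (n + 1)) {F : (Fin (n + 1) → ℝ) → ℂ}
    (hF : Integrable F) : ∫ X, F X = ∫ z : ℝ, ∫ X : Fin n → ℝ, F (k.insertNth z X) := by
  have h := (volume_preserving_piFinSuccAbove (fun _ : Fin (n + 1) => ℝ) k).symm
  rw [← h.integral_comp (MeasurableEquiv.measurableEmbedding _), Measure.volume_eq_prod,
    integral_prod]
  · rfl
  · rw [← Measure.volume_eq_prod]
    exact h.integrable_comp_of_integrable hF

theorem volume_real_univ_empty : (volume : Measure (Fin 0 → ℝ)).real univ = 1 := by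
  simp [measureReal_def, volume_pi]

/-- The `n`-th coefficient of the Fredholm determinant with weight `w`. -/
def detTerm (n : ℕ) (w : ℝ → ℂ) : ℂ :=
  ∫ X : Fin n → ℝ, (kerDet X X : ℂ) * ∏ i, w (X i)

/-- The `n`-th coefficient of the first Fredholm minor with weight `w`. -/
def minorTerm (n : ℕ) (w : ℝ → ℂ) (x y : ℝ) : ℂ :=
  ∫ X : Fin n → ℝ, (kerDet (Fin.cons x X : Fin (n + 1) → ℝ) (Fin.cons y X : Fin (n + 1) → ℝ) : ℂ) *
    ∏ i, w (X i)

theorem minorTerm_comm (n : ℕ) (w : ℝ → ℂ) (x y : ℝ) :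
    minorTerm n w x y = minorTerm n w y x := by
  unfold minorTerm
  simp_rw [kerDet_comm (Fin.cons x _)]

theorem continuous_cons_kerDet {n : ℕ} :
    Continuous fun p : (ℝ × ℝ) × (Fin n → ℝ) => (kerDet (Fin.cons p.1.1 p.2 : Fin (n + 1) → ℝ)
      (Fin.cons p.1.2 p.2 : Fin (n + 1) → ℝ) : ℂ) :=
  Complex.continuous_ofReal.comp
    (continuous_kerDet
      (Continuous.finCons (A := fun _ => ℝ) (f := fun p : (ℝ × ℝ) × (Fin n → ℝ) => p.1.1)
        (by fun_prop) continuous_snd)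
      (Continuous.finCons (A := fun _ => ℝ) (f := fun p : (ℝ × ℝ) × (Fin n → ℝ) => p.1.2)
        (by fun_prop) continuous_snd))

theorem continuous_kerDet_self {n : ℕ} :
    Continuous fun X : Fin n → ℝ => (kerDet X X : ℂ) :=
  Complex.continuous_ofReal.comp (continuous_kerDet continuous_id continuous_id)

section weight

variable {w : ℝ → ℂ}

theorem norm_minorTerm_le (hw : Integrable w) (n : ℕ) (x y : ℝ) :
    ‖minorTerm n w x y‖ ≤ √((n + 1 : ℕ) : ℝ) ^ (n + 1) * (∫ y, ‖w y‖) ^ n := by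
  refine (norm_integral_mul_prod_le (n := n) (fun _ => hw) fun X => norm_kerDet_le _ _).trans ?_
  simp

theorem norm_detTerm_le (hw : Integrable w) (n : ℕ) :
    ‖detTerm n w‖ ≤ √(n : ℝ) ^ n * (∫ y, ‖w y‖) ^ n := by
  refine (norm_integral_mul_prod_le (n := n) (fun _ => hw) fun X => norm_kerDet_le _ _).trans ?_
  simp

theorem continuous_minorTerm (hw : Integrable w) (n : ℕ) :
    Continuous fun p : ℝ × ℝ => minorTerm n w p.1 p.2 := by
  refine continuous_of_dominated (bound := fun X : Fin n → ℝ =>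
    √((n + 1 : ℕ) : ℝ) ^ (n + 1) * ‖∏ i, w (X i)‖) (fun p => ?_) (fun p => ?_) ?_ ?_
  · exact (integrable_mul_prod (fun _ => hw) (continuous_cons_kerDet.comp
      (by fun_prop : Continuous fun X : Fin n → ℝ => (p, X)))
      (fun X => norm_kerDet_le _ _)).aestronglyMeasurable
  · refine Eventually.of_forall fun X => ?_
    rw [norm_mul]
    exact mul_le_mul_of_nonneg_right (norm_kerDet_le _ _) (norm_nonneg _)
  · exact (Integrable.fintype_prod (𝕜 := ℂ) fun _ => hw).norm.const_mul _
  · refine Eventually.of_forall fun X => ?_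
    exact (continuous_cons_kerDet.comp
      (by fun_prop : Continuous fun p : ℝ × ℝ => (p, X))).mul continuous_const

theorem minorTerm_zero (x y : ℝ) : minorTerm 0 w x y = sineKernel x y := by
  simp [minorTerm, kerDet, volume_real_univ_empty]

/-- After expansion along the first row, Fubini's theorem in the `k`-th variable turns each of the n
+ 1 off-corner terms into the same integral. -/
theorem minorTerm_succ (hw : Integrable w) (n : ℕ) (x y : ℝ) :
    minorTerm (n + 1) w x y = sineKernel x y * detTerm (n + 1) w -
      (n + 1) * ∫ z, sineKernel x z * w z * minorTerm n w z y := by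
  have hc : Continuous fun X : Fin (n + 1) → ℝ =>
      (kerDet X X : ℂ) := continuous_kerDet_self
  have hk : ∀ k : Fin (n + 1), Integrable fun X : Fin (n + 1) → ℝ =>
      ((sineKernel x (X k) * kerDet (Fin.cons (X k) (k.removeNth X) : Fin (n + 1) → ℝ)
          (Fin.cons y (k.removeNth X) : Fin (n + 1) → ℝ) : ℝ) : ℂ) * ∏ i, w (X i) := by
    intro k
    refine integrable_mul_prod (fun _ => hw) (C := 1 * √((n + 1 : ℕ) : ℝ) ^ (n + 1)) ?_ fun X => ?_
    · refine Complex.continuous_ofReal.comp (Continuous.mul ?_ ?_)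
      · exact continuous_sineKernel.comp (continuous_const.prodMk (continuous_apply k))
      · have hr : Continuous fun X : Fin (n + 1) → ℝ => k.removeNth X :=
          continuous_pi fun i => continuous_apply _
        exact continuous_kerDet ((continuous_apply k).finCons hr) (continuous_const.finCons hr)
    · rw [Complex.norm_real, norm_mul]
      exact mul_le_mul (abs_sineKernel_le_one _ _) (abs_kerDet_le _ _) (norm_nonneg _) zero_le_one
  have hI : ∀ k : Fin (n + 1), ∫ X : Fin (n + 1) → ℝ,
      ((sineKernel x (X k) * kerDet (Fin.cons (X k) (k.removeNth X) : Fin (n + 1) → ℝ)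
          (Fin.cons y (k.removeNth X) : Fin (n + 1) → ℝ) : ℝ) : ℂ) * ∏ i, w (X i) =
      ∫ z, sineKernel x z * w z * minorTerm n w z y := by
    intro k
    rw [integral_eq_integral_insertNth k (hk k)]
    refine integral_congr_ae (Eventually.of_forall fun z => ?_)
    simp only [Fin.insertNth_apply_same, Fin.removeNth_insertNth, Fin.prod_univ_succAbove _ k,
      Fin.insertNth_apply_succAbove, minorTerm]
    rw [← integral_const_mul]
    refine integral_congr_ae (Eventually.of_forall fun X => ?_)
    push_cast
    ring
  have h0 : Integrable fun X : Fin (n + 1) → ℝ =>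
      (sineKernel x y : ℂ) * ((kerDet X X : ℂ) * ∏ i, w (X i)) :=
    (integrable_mul_prod (fun _ => hw) hc fun X => norm_kerDet_le _ _).const_mul _
  calc minorTerm (n + 1) w x y = ∫ X : Fin (n + 1) → ℝ,
        ((sineKernel x y : ℂ) * ((kerDet X X : ℂ) * ∏ i, w (X i)) - ∑ k : Fin (n + 1),
          ((sineKernel x (X k) * kerDet (Fin.cons (X k) (k.removeNth X) : Fin (n + 1) → ℝ)
          (Fin.cons y (k.removeNth X) : Fin (n + 1) → ℝ) : ℝ) : ℂ) * ∏ i, w (X i)) := by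
        unfold minorTerm
        refine integral_congr_ae (Eventually.of_forall fun X => ?_)
        simp only [kerDet_cons_insert, Complex.ofReal_sub, Complex.ofReal_mul,
          Complex.ofReal_sum, sub_mul, Finset.sum_mul, mul_assoc]
    _ = _ := by
        rw [integral_sub h0 (integrable_finsetSum _ fun k _ => hk k),
          integral_finsetSum _ fun k _ => hk k, integral_const_mul]
        simp only [hI, Finset.sum_const, Finset.card_univ, Fintype.card_fin, nsmul_eq_mul]
        push_cast
        rfl

/-- The Fredholm determinant with weight `w`. -/
def weightedDet (w : ℝ → ℂ) : ℂ := ∑' n : ℕ, (-1 : ℂ) ^ n / (n.factorial : ℂ) * detTerm n w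

/-- The first Fredholm minor with weight `w`. -/
def weightedMinor (w : ℝ → ℂ) (x y : ℝ) : ℂ :=
  ∑' n : ℕ, (-1 : ℂ) ^ n / (n.factorial : ℂ) * minorTerm n w x y

theorem norm_sign_div_factorial (n : ℕ) :
    ‖(-1 : ℂ) ^ n / (n.factorial : ℂ)‖ = 1 / (n.factorial : ℝ) := by
  simp

theorem summable_minor_bound (w : ℝ → ℂ) : Summable fun n : ℕ =>
    √((n + 1 : ℕ) : ℝ) ^ (n + 1) / (n.factorial : ℝ) * (∫ y, ‖w y‖) ^ n :=
  summable_hadamard (integral_nonneg fun _ => norm_nonneg _)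

theorem norm_minor_summand_le (hw : Integrable w) (n : ℕ) (x y : ℝ) :
    ‖(-1 : ℂ) ^ n / (n.factorial : ℂ) * minorTerm n w x y‖ ≤
      √((n + 1 : ℕ) : ℝ) ^ (n + 1) / (n.factorial : ℝ) * (∫ y, ‖w y‖) ^ n := by
  rw [norm_mul, norm_sign_div_factorial]
  calc _ ≤ 1 / (n.factorial : ℝ) * (√((n + 1 : ℕ) : ℝ) ^ (n + 1) * (∫ y, ‖w y‖) ^ n) := by
        gcongr
        exact norm_minorTerm_le hw n x y
    _ = _ := by ring

theorem summable_minor (hw : Integrable w) (x y : ℝ) :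
    Summable fun n : ℕ => (-1 : ℂ) ^ n / (n.factorial : ℂ) * minorTerm n w x y :=
  Summable.of_norm_bounded (summable_minor_bound w) fun n => norm_minor_summand_le hw n x y

theorem summable_det (hw : Integrable w) :
    Summable fun n : ℕ => (-1 : ℂ) ^ n / (n.factorial : ℂ) * detTerm n w := by
  -- Shifted by one, the determinant coefficients are controlled by the bound for the minors times
  -- one more factor ∫‖w‖.
  rw [← summable_nat_add_iff 1]
  refine Summable.of_norm_bounded ((summable_minor_bound w).mul_right (∫ y, ‖w y‖)) fun n => ?_
  rw [norm_mul, norm_sign_div_factorial]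
  have hW : 0 ≤ ∫ y, ‖w y‖ := integral_nonneg fun _ => norm_nonneg _
  calc _ ≤ 1 / (n.factorial : ℝ) *
        (√((n + 1 : ℕ) : ℝ) ^ (n + 1) * (∫ y, ‖w y‖) ^ (n + 1)) := by
        gcongr
        · omega
        · exact norm_detTerm_le hw (n + 1)
    _ = _ := by ring

theorem weightedMinor_comm (x y : ℝ) : weightedMinor w x y = weightedMinor w y x := by
  unfold weightedMinor
  simp_rw [minorTerm_comm _ w x y]

theorem continuous_weightedMinor (hw : Integrable w) :
    Continuous fun p : ℝ × ℝ => weightedMinor w p.1 p.2 :=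
  continuous_tsum (fun n => continuous_const.mul (continuous_minorTerm hw n))
    (summable_minor_bound w) fun n p => norm_minor_summand_le hw n p.1 p.2

theorem norm_weightedMinor_le (hw : Integrable w) (x y : ℝ) : ‖weightedMinor w x y‖ ≤
    ∑' n : ℕ, √((n + 1 : ℕ) : ℝ) ^ (n + 1) / (n.factorial : ℝ) * (∫ y, ‖w y‖) ^ n :=
  tsum_of_norm_bounded (summable_minor_bound w).hasSum fun n => norm_minor_summand_le hw n x y

/-- Termwise integration of the first Fredholm minor. -/
theorem hasSum_integral_minor (hw : Integrable w) {g : ℝ → ℂ} (hg : Integrable g) {u v : ℝ → ℝ}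
    (hu : Continuous u) (hv : Continuous v) :
    HasSum (fun n : ℕ => (-1 : ℂ) ^ n / (n.factorial : ℂ) *
      ∫ z, g z * minorTerm n w (u z) (v z)) (∫ z, g z * weightedMinor w (u z) (v z)) := by
  have hb : ∀ (n : ℕ) (z : ℝ),
      ‖g z * ((-1 : ℂ) ^ n / (n.factorial : ℂ) * minorTerm n w (u z) (v z))‖ ≤
      ‖g z‖ * (√((n + 1 : ℕ) : ℝ) ^ (n + 1) / (n.factorial : ℝ) * (∫ y, ‖w y‖) ^ n) := by
    intro n z
    rw [norm_mul]
    exact mul_le_mul_of_nonneg_left (norm_minor_summand_le hw n _ _) (norm_nonneg _)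
  have hi : ∀ n : ℕ, Integrable fun z =>
      g z * ((-1 : ℂ) ^ n / (n.factorial : ℂ) * minorTerm n w (u z) (v z)) := by
    intro n
    refine (hg.norm.mul_const _).mono' (hg.aestronglyMeasurable.mul ?_)
      (Eventually.of_forall (hb n))
    exact (continuous_const.mul
      ((continuous_minorTerm hw n).comp (hu.prodMk hv))).aestronglyMeasurable
  have h := hasSum_integral_of_summable_integral_norm hi ?_
  · simp only [mul_left_comm (g _), integral_const_mul] at h
    simp only [← mul_left_comm (g _), tsum_mul_left] at h
    exact h
  · refine Summable.of_nonneg_of_le (fun n => integral_nonneg fun _ => norm_nonneg _) (fun n => ?_)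
      ((summable_minor_bound w).mul_left (∫ z, ‖g z‖))
    rw [← integral_mul_const]
    exact integral_mono (hi n).norm (hg.norm.mul_const _) (hb n)

theorem integrable_sineKernel_mul (hw : Integrable w) (x : ℝ) :
    Integrable fun z => (sineKernel x z : ℂ) * w z := by
  refine hw.bdd_mul (c := 1) ?_ (Eventually.of_forall fun z => ?_)
  · exact (Complex.continuous_ofReal.comp (continuous_sineKernel.comp
      (by fun_prop : Continuous fun z : ℝ => (x, z)))).aestronglyMeasurable
  · rw [Complex.norm_real]
    exact abs_sineKernel_le_one x z

/-- The first Fredholm identity. -/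
theorem weightedMinor_eq (hw : Integrable w) (x y : ℝ) :
    weightedMinor w x y = sineKernel x y * weightedDet w +
      ∫ z, sineKernel x z * w z * weightedMinor w z y := by
  have h := hasSum_integral_minor hw (integrable_sineKernel_mul hw x) continuous_id
    (continuous_const (y := y))
  have h0 : detTerm 0 w = 1 := by simp [detTerm, kerDet, volume_real_univ_empty]
  simp only [id_eq] at h
  -- Both series are split at n = 0, where the minor is K(x, y) and the determinant coefficient is
  -- 1. In degree n + 1 the factor -(n + 1) of `minorTerm_succ` turns (-1)^(n+1)/(n+1)! into
  -- (-1)ⁿ/n!.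
  rw [weightedMinor, (summable_minor hw x y).tsum_eq_zero_add, weightedDet, (summable_det hw).tsum_eq_zero_add,
    ← h.tsum_eq, mul_add, ← tsum_mul_left, add_assoc, ← Summable.tsum_add]
  · simp only [minorTerm_zero, h0, pow_zero, Nat.factorial_zero, Nat.cast_one, div_one, one_mul,
      mul_one]
    congr 1
    refine tsum_congr fun n => ?_
    rw [minorTerm_succ hw, Nat.factorial_succ, pow_succ]
    have h1 : ((n : ℂ) + 1) ≠ 0 := by exact_mod_cast n.succ_ne_zero
    have h2 : (n.factorial : ℂ) ≠ 0 := by exact_mod_cast n.factorial_ne_zero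
    push_cast
    field_simp
    ring
  · exact ((summable_nat_add_iff 1).2 (summable_det hw)).mul_left _
  · exact h.summable

end weight

/-! ### The determinant as a differentiable function of the weight in L¹ -/

theorem prod_update_apply {ι : Type*} [Fintype ι] [DecidableEq ι] (W : ι → ℝ →₁[volume] ℂ) (i : ι)
    (h : ℝ →₁[volume] ℂ) (X : ι → ℝ) :
    ∏ j, (Function.update W i h j : ℝ → ℂ) (X j) =
      h (X i) * ∏ j ∈ Finset.univ.erase i, W j (X j) := by
  rw [← Finset.mul_prod_erase _ _ (Finset.mem_univ i), Function.update_self]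
  congr 1
  refine Finset.prod_congr rfl fun j hj => ?_
  rw [Function.update_of_ne (Finset.ne_of_mem_erase hj)]

theorem integrable_kerDet_self_mul {n : ℕ} (W : Fin n → ℝ →₁[volume] ℂ) :
    Integrable fun X : Fin n → ℝ => (kerDet X X : ℂ) * ∏ i, W i (X i) :=
  integrable_mul_prod (fun i => L1.integrable_coeFn (W i)) continuous_kerDet_self
    fun X => norm_kerDet_le X X

theorem ae_eval {n : ℕ} (i : Fin n) {p : ℝ → Prop} (hp : ∀ᵐ y, p y) :
    ∀ᵐ X : Fin n → ℝ, p (X i) :=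
  (Measure.quasiMeasurePreserving_eval (μ := fun _ : Fin n => (volume : Measure ℝ)) i).ae hp

/-- The multilinear form `(w₁, …, wₙ) ↦ ∫ det (K(xᵢ, xⱼ)) w₁(x₁) ⋯ wₙ(xₙ) dx` on `L¹`. -/
def kerForm (n : ℕ) : ContinuousMultilinearMap ℂ (fun _ : Fin n => ℝ →₁[volume] ℂ) ℂ :=
  MultilinearMap.mkContinuous
    { toFun := fun W => ∫ X : Fin n → ℝ, (kerDet X X : ℂ) * ∏ i, W i (X i)
      map_update_add' := fun W i f g => by
        rw [← integral_add (integrable_kerDet_self_mul _) (integrable_kerDet_self_mul _)]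
        refine integral_congr_ae ?_
        filter_upwards [ae_eval i (Lp.coeFn_add f g)] with X hX
        simp only [prod_update_apply, hX, Pi.add_apply]
        ring
      map_update_smul' := fun W i c f => by
        rw [smul_eq_mul, ← integral_const_mul]
        refine integral_congr_ae ?_
        filter_upwards [ae_eval i (Lp.coeFn_smul c f)] with X hX
        simp only [prod_update_apply, hX, Pi.smul_apply, smul_eq_mul]
        ring }
    (√(n : ℝ) ^ n)
    (fun W => by
      simp only [L1.norm_eq_integral_norm]
      exact norm_integral_mul_prod_le (fun i => L1.integrable_coeFn (W i))
        fun X => norm_kerDet_le X X)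

theorem kerForm_apply {n : ℕ} (W : Fin n → ℝ →₁[volume] ℂ) :
    kerForm n W = ∫ X : Fin n → ℝ, (kerDet X X : ℂ) * ∏ i, W i (X i) := rfl

/-- The result does not depend on the slot `i`, since the distinguished variable can be moved to the
front of rows and columns simultaneously. Hence the factor n + 1 in `detTermDeriv_apply`. -/
theorem kerForm_update {n : ℕ} (w h : ℝ →₁[volume] ℂ) (i : Fin (n + 1)) :
    kerForm (n + 1) (Function.update (fun _ => w) i h) = ∫ y, h y * minorTerm n w y y := by
  rw [kerForm_apply, integral_eq_integral_insertNth i (integrable_kerDet_self_mul _)]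
  refine integral_congr_ae (Eventually.of_forall fun y => ?_)
  simp only [minorTerm]
  rw [← integral_const_mul]
  refine integral_congr_ae (Eventually.of_forall fun X => ?_)
  simp only [Fin.prod_univ_succAbove _ i, Function.update_self, Fin.insertNth_apply_same,
    Fin.insertNth_apply_succAbove, ne_eq, Fin.succAbove_ne, not_false_eq_true,
    Function.update_of_ne, kerDet_insertNth_self]
  ring

/-- The derivative of `w ↦ detTerm (n + 1) w` on `L¹`. -/
def detTermDeriv (n : ℕ) (w : ℝ →₁[volume] ℂ) : (ℝ →₁[volume] ℂ) →L[ℂ] ℂ :=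
  ((kerForm (n + 1)).linearDeriv fun _ => w).comp
    (ContinuousLinearMap.pi fun _ => ContinuousLinearMap.id ℂ _)

theorem detTermDeriv_apply (n : ℕ) (w h : ℝ →₁[volume] ℂ) :
    detTermDeriv n w h = (n + 1) * ∫ y, h y * minorTerm n w y y := by
  simp [detTermDeriv, ContinuousMultilinearMap.linearDeriv_apply, kerForm_update]

theorem hasFDerivAt_detTerm (n : ℕ) (w : ℝ →₁[volume] ℂ) :
    HasFDerivAt (fun w : ℝ →₁[volume] ℂ => detTerm (n + 1) w) (detTermDeriv n w) w := by
  have h1 := (kerForm (n + 1)).hasFDerivAt fun _ => w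
  have h2 := (ContinuousLinearMap.pi fun _ : Fin (n + 1) =>
    ContinuousLinearMap.id ℂ (ℝ →₁[volume] ℂ)).hasFDerivAt (x := w)
  exact HasFDerivAt.comp w h1 h2

theorem norm_detTermDeriv_le (n : ℕ) (w : ℝ →₁[volume] ℂ) :
    ‖detTermDeriv n w‖ ≤ (n + 1) * (√((n + 1 : ℕ) : ℝ) ^ (n + 1) * ‖w‖ ^ n) := by
  refine ContinuousLinearMap.opNorm_le_bound _ (by positivity) fun h => ?_
  rw [detTermDeriv_apply, norm_mul, mul_assoc]
  have e : ‖(n : ℂ) + 1‖ = n + 1 := by exact_mod_cast Complex.norm_natCast (n + 1)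
  rw [e]
  refine mul_le_mul_of_nonneg_left ?_ (by positivity)
  rw [L1.norm_eq_integral_norm h, mul_comm, ← integral_mul_const]
  refine norm_integral_le_of_norm_le ((L1.integrable_coeFn h).norm.mul_const _)
    (Eventually.of_forall fun y => ?_)
  rw [norm_mul, L1.norm_eq_integral_norm w]
  exact mul_le_mul_of_nonneg_left (norm_minorTerm_le (L1.integrable_coeFn w) n y y) (norm_nonneg _)

/-- The Fredholm determinant is differentiable in the weight, as an element of `L¹`, and its
derivative is given by the diagonal of the first Fredholm minor. -/
theorem exists_hasFDerivAt_weightedDet (w : ℝ →₁[volume] ℂ) :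
    ∃ F : (ℝ →₁[volume] ℂ) →L[ℂ] ℂ,
      HasFDerivAt (fun w : ℝ →₁[volume] ℂ => weightedDet w) F w ∧
        ∀ h : ℝ →₁[volume] ℂ, F h = -∫ y, h y * weightedMinor w y y := by
  have hint : ∀ v : ℝ →₁[volume] ℂ, Integrable (v : ℝ → ℂ) := L1.integrable_coeFn
  let c : ℕ → ℂ := fun n => (-1 : ℂ) ^ (n + 1) / ((n + 1).factorial : ℂ)
  have hu : Summable fun n : ℕ =>
      √((n + 1 : ℕ) : ℝ) ^ (n + 1) / (n.factorial : ℝ) * (‖w‖ + 1) ^ n :=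
    summable_hadamard (by positivity)
  have hle : ∀ n : ℕ, ∀ v ∈ Metric.ball (0 : ℝ →₁[volume] ℂ) (‖w‖ + 1),
      ‖c n • detTermDeriv n v‖ ≤
        √((n + 1 : ℕ) : ℝ) ^ (n + 1) / (n.factorial : ℝ) * (‖w‖ + 1) ^ n := by
    intro n v hv
    have hv' : ‖v‖ ≤ ‖w‖ + 1 := (mem_ball_zero_iff.1 hv).le
    rw [norm_smul, norm_sign_div_factorial]
    calc _ ≤ 1 / ((n + 1).factorial : ℝ) *
          ((n + 1) * (√((n + 1 : ℕ) : ℝ) ^ (n + 1) * (‖w‖ + 1) ^ n)) := by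
          gcongr
          exact (norm_detTermDeriv_le n v).trans (by gcongr)
      _ = _ := by
          rw [Nat.factorial_succ]
          push_cast
          field_simp
  have hw : w ∈ Metric.ball (0 : ℝ →₁[volume] ℂ) (‖w‖ + 1) := by
    rw [mem_ball_zero_iff]
    linarith
  -- Termwise differentiation needs a summable bound on the derivatives that is uniform near `w`;
  -- the ball of radius ‖w‖ + 1 about 0 provides it. The sum starts in degree 1 because the
  -- coefficient of degree 0 is the constant 1.
  have hd := hasFDerivAt_tsum_of_isPreconnected (𝕜 := ℂ) hu Metric.isOpen_ball
    (convex_ball (0 : ℝ →₁[volume] ℂ) (‖w‖ + 1)).isPreconnected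
    (fun n v _ => (hasFDerivAt_detTerm n v).const_mul (c n)) hle hw
    ((summable_nat_add_iff 1).2 (summable_det (hint w))) hw
  refine ⟨∑' n, c n • detTermDeriv n w, ?_, fun h => ?_⟩
  · have e : (fun v : ℝ →₁[volume] ℂ => weightedDet v) = fun v : ℝ →₁[volume] ℂ =>
        1 + ∑' n : ℕ, c n * detTerm (n + 1) v := by
      funext v
      rw [weightedDet, (summable_det (hint v)).tsum_eq_zero_add]
      simp [detTerm, kerDet, volume_real_univ_empty, c]
    rw [e]
    exact hd.const_add 1
  · have hs : Summable fun n => c n • detTermDeriv n w :=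
      Summable.of_norm_bounded hu fun n => hle n w hw
    have h1 : (∑' n, c n • detTermDeriv n w) h = ∑' n, c n * detTermDeriv n w h :=
      (ContinuousLinearMap.apply ℂ ℂ h).map_tsum hs
    have h2 := (hasSum_integral_minor (hint w) (hint h) continuous_id continuous_id).tsum_eq
    simp only [id_eq] at h2
    rw [h1, ← h2, ← tsum_neg]
    refine tsum_congr fun n => ?_
    have h1 : ((n : ℂ) + 1) ≠ 0 := by exact_mod_cast n.succ_ne_zero
    have h2 : (n.factorial : ℂ) ≠ 0 := by exact_mod_cast n.factorial_ne_zero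
    simp only [detTermDeriv_apply, c, Nat.factorial_succ, pow_succ]
    push_cast
    field_simp

/-! ### Endpoints, integrals over the intervals and the derivative of the determinant -/

section

variable {m : ℕ}

/-- The index of the left endpoint of the `k`-th interval. -/
def leftIdx (k : Fin m) : Fin (2 * m) := ⟨2 * k.1, by omega⟩

/-- The index of the right endpoint of the `k`-th interval. -/
def rightIdx (k : Fin m) : Fin (2 * m) := ⟨2 * k.1 + 1, by omega⟩

theorem leftEnd_eq (a : Fin (2 * m) → ℝ) (k : Fin m) : leftEnd a k = a (leftIdx k) := rfl

theorem rightEnd_eq (a : Fin (2 * m) → ℝ) (k : Fin m) : rightEnd a k = a (rightIdx k) := rfl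

theorem eq_leftIdx_or_eq_rightIdx (j : Fin (2 * m)) :
    ∃ k : Fin m, j = leftIdx k ∨ j = rightIdx k := by
  refine ⟨⟨j.1 / 2, by omega⟩, ?_⟩
  simp only [leftIdx, rightIdx, Fin.ext_iff]
  omega

theorem leftIdx_ne_rightIdx (k l : Fin m) : leftIdx k ≠ rightIdx l := by
  simp only [leftIdx, rightIdx, ne_eq, Fin.mk.injEq]
  omega

theorem sgn_leftIdx (k : Fin m) : sgn (leftIdx k) = -1 := by
  simp [sgn, leftIdx, pow_succ, pow_mul]

theorem sgn_rightIdx (k : Fin m) : sgn (rightIdx k) = 1 := by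
  simp [sgn, rightIdx, pow_succ, pow_mul]

theorem sum_sgn_smul {E : Type*} [AddCommGroup E] [Module ℂ E] (F : Fin (2 * m) → E) :
    ∑ j, sgn j • F j = ∑ k : Fin m, (F (rightIdx k) - F (leftIdx k)) := by
  let e : Fin m × Fin 2 ≃ Fin (2 * m) := finProdFinEquiv.trans (finCongr (mul_comm m 2))
  have h0 : ∀ k : Fin m, e (k, 0) = leftIdx k := fun k => by
    ext
    simp [e, leftIdx]
  have h1 : ∀ k : Fin m, e (k, 1) = rightIdx k := fun k => by
    ext
    simp [e, rightIdx, add_comm]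
  rw [← e.sum_comp, Fintype.sum_prod_type]
  refine Finset.sum_congr rfl fun k _ => ?_
  rw [Fin.sum_univ_two, h0, h1, sgn_leftIdx, sgn_rightIdx, neg_one_smul, one_smul]
  abel

/-- Disjointness gives only `≤`; equality would make a right endpoint coincide with a left one. The
strict inequality is what makes admissibility an open condition. -/
theorem Admissible.max_left_gt_min_right {a : Fin (2 * m) → ℝ} (ha : Admissible a) {k l : Fin m}
    (hkl : k ≠ l) : min (rightEnd a k) (rightEnd a l) < max (leftEnd a k) (leftEnd a l) := by
  refine lt_of_le_of_ne (Ioo_disjoint_Ioo.1 (ha.disjoint hkl)) fun h => ?_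
  have hne : ∀ i j : Fin m, rightEnd a i ≠ leftEnd a j := fun i j h =>
    leftIdx_ne_rightIdx j i (ha.injective h.symm)
  rcases min_choice (rightEnd a k) (rightEnd a l) with h1 | h1 <;>
  rcases max_choice (leftEnd a k) (leftEnd a l) with h2 | h2 <;>
  · rw [h1, h2] at h
    exact hne _ _ h

/-- Admissibility is an open condition. -/
theorem Admissible.eventually {a : Fin (2 * m) → ℝ} (ha : Admissible a) :
    ∀ᶠ b in 𝓝 a, Admissible b := by
  have hl : ∀ k : Fin m, Continuous fun b : Fin (2 * m) → ℝ => leftEnd b k :=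
    fun k => continuous_apply _
  have hr : ∀ k : Fin m, Continuous fun b : Fin (2 * m) → ℝ => rightEnd b k :=
    fun k => continuous_apply _
  have h1 : ∀ᶠ b : Fin (2 * m) → ℝ in 𝓝 a, ∀ k, leftEnd b k < rightEnd b k :=
    eventually_all.2 fun k => (hl k).continuousAt.eventually_lt (hr k).continuousAt (ha.lt k)
  have h2 : ∀ᶠ b : Fin (2 * m) → ℝ in 𝓝 a, ∀ k l : Fin m, k ≠ l →
      min (rightEnd b k) (rightEnd b l) < max (leftEnd b k) (leftEnd b l) := by
    refine eventually_all.2 fun k => eventually_all.2 fun l => ?_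
    by_cases hkl : k = l
    · exact Eventually.of_forall fun b h => absurd hkl h
    · filter_upwards [((hr k).min (hr l)).continuousAt.eventually_lt
        ((hl k).max (hl l)).continuousAt (ha.max_left_gt_min_right hkl)] with b hb _ using hb
  have h3 : ∀ᶠ b : Fin (2 * m) → ℝ in 𝓝 a, ∀ i j : Fin (2 * m), i ≠ j → b i ≠ b j := by
    refine eventually_all.2 fun i => eventually_all.2 fun j => ?_
    by_cases hij : i = j
    · exact Eventually.of_forall fun b h => absurd hij h
    · filter_upwards [(isOpen_ne_fun (continuous_apply (A := fun _ => ℝ) i)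
        (continuous_apply j)).mem_nhds (x := a) (ha.injective.ne hij)] with b hb _ using hb
  filter_upwards [h1, h2, h3] with b hb1 hb2 hb3
  exact ⟨hb1, fun k l hkl => Ioo_disjoint_Ioo.2 (hb2 k l hkl).le,
    fun i j h => by_contra fun hij => hb3 i j hij h⟩

theorem Admissible.mem_closure {a : Fin (2 * m) → ℝ} (ha : Admissible a) (j : Fin (2 * m)) :
    a j ∈ closure (intervals a) := by
  obtain ⟨k, hk⟩ := eq_leftIdx_or_eq_rightIdx j
  have hsub : closure (interval a k) ⊆ closure (intervals a) :=
    closure_mono (subset_iUnion (interval a) k)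
  rw [interval, closure_Ioo (ha.lt k).ne] at hsub
  rcases hk with rfl | rfl
  · exact hsub (left_mem_Icc.2 (ha.lt k).le)
  · exact hsub (right_mem_Icc.2 (ha.lt k).le)

theorem Admissible.neBot {a : Fin (2 * m) → ℝ} (ha : Admissible a) (j : Fin (2 * m)) :
    (𝓝[intervals a] (a j)).NeBot :=
  mem_closure_iff_nhdsWithin_neBot.1 (ha.mem_closure j)

theorem integrableOn_intervals {E : Type*} [NormedAddCommGroup E] {g : ℝ → E} (hg : Continuous g)
    (b : Fin (2 * m) → ℝ) : IntegrableOn g (intervals b) := by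
  rw [intervals, integrableOn_finite_iUnion]
  exact fun k => (hg.integrableOn_Icc).mono_set Ioo_subset_Icc_self

section calculus

variable {E : Type*} [NormedAddCommGroup E] [NormedSpace ℂ E]

/-- A primitive with base point 0 separates the endpoints: each `b j` enters a single summand, to
which the fundamental theorem of calculus applies. -/
theorem Admissible.integral_intervals [CompleteSpace E] {b : Fin (2 * m) → ℝ} (hb : Admissible b) {g : ℝ → E}
    (hg : Continuous g) :
    ∫ y in intervals b, g y = ∑ j, sgn j • ∫ y in (0 : ℝ)..b j, g y := by
  rw [sum_sgn_smul, intervals, integral_iUnion_fintype (s := interval b)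
    (fun k => measurableSet_Ioo) hb.disjoint (fun k => (hg.integrableOn_Icc).mono_set Ioo_subset_Icc_self)]
  refine Finset.sum_congr rfl fun k _ => ?_
  rw [interval, ← integral_Ioc_eq_integral_Ioo, ← intervalIntegral.integral_of_le (hb.lt k).le,
    leftEnd_eq, rightEnd_eq, intervalIntegral.integral_interval_sub_left
      (hg.intervalIntegrable _ _) (hg.intervalIntegrable _ _)]

/-- The linear form `v ↦ ∑ j, sgn j * v j • e j`. -/
def endpointForm (e : Fin (2 * m) → E) : (Fin (2 * m) → ℝ) →L[ℝ] E :=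
  ∑ j, (ContinuousLinearMap.proj (R := ℝ) (φ := fun _ : Fin (2 * m) => ℝ) j).smulRight
    (sgn j • e j)

theorem endpointForm_apply (e : Fin (2 * m) → E) (v : Fin (2 * m) → ℝ) :
    endpointForm e v = ∑ j, v j • sgn j • e j := by
  simp [endpointForm]

/-- The derivative of an integral over the union of intervals with respect to the endpoints. -/
theorem Admissible.hasFDerivAt_integral [CompleteSpace E] {a : Fin (2 * m) → ℝ}
    (ha : Admissible a) {g : ℝ → E} (hg : Continuous g) : HasFDerivAt (fun b => ∫ y in intervals b, g y)
      (endpointForm fun j => g (a j)) a := by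
  have h : HasFDerivAt (fun b : Fin (2 * m) → ℝ => ∑ j, sgn j • ∫ y in (0 : ℝ)..b j, g y)
      (endpointForm fun j => g (a j)) a := by
    refine HasFDerivAt.fun_sum fun j _ => ?_
    have h1 := (hg.integral_hasStrictDerivAt 0 (a j)).hasDerivAt.hasFDerivAt.comp a
      (ContinuousLinearMap.proj (R := ℝ) (φ := fun _ : Fin (2 * m) => ℝ) j).hasFDerivAt
    convert! h1.const_smul (sgn j) using 1
    ext v
    exact (smul_comm _ _ _)
  exact h.congr_of_eventuallyEq (ha.eventually.mono fun b hb => hb.integral_intervals hg)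

end calculus

/-- The weight `λ χ_I`. -/
def weight (lam : ℂ) (a : Fin (2 * m) → ℝ) : ℝ → ℂ := (intervals a).indicator fun _ => lam

theorem integrable_weight (lam : ℂ) (a : Fin (2 * m) → ℝ) : Integrable (weight lam a) := by
  rw [weight, integrable_indicator_iff (measurableSet_intervals a)]
  exact integrableOn_const (volume_intervals_lt_top a).ne

theorem kernel_eq (lam : ℂ) (a : Fin (2 * m) → ℝ) (x y : ℝ) :
    kernel lam a x y = sineKernel x y * weight lam a y := by
  by_cases hy : y ∈ intervals a <;> simp [kernel, weight, hy, mul_comm]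

theorem integral_mul_weight (lam : ℂ) (a : Fin (2 * m) → ℝ) (g : ℝ → ℂ) :
    ∫ y, weight lam a y * g y = ∫ y in intervals a, lam * g y := by
  rw [← integral_indicator (measurableSet_intervals a)]
  refine integral_congr_ae (Eventually.of_forall fun y => ?_)
  by_cases hy : y ∈ intervals a <;> simp [weight, hy]

/-- A point gained by an interval has been swept over by one of its two endpoints. This bounds the
L¹ distance of two weights by the displacements of the endpoints. -/
theorem mem_uIcc_of_mem_intervals {a b : Fin (2 * m) → ℝ} {y : ℝ} (hb : y ∈ intervals b)
    (ha : y ∉ intervals a) : ∃ j, y ∈ uIcc (a j) (b j) := by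
  obtain ⟨k, hk⟩ := mem_iUnion.1 hb
  have hak : ¬ y ∈ interval a k := fun h => ha (mem_iUnion.2 ⟨k, h⟩)
  simp only [interval, mem_Ioo, leftEnd_eq, rightEnd_eq, not_and_or, not_lt] at hk hak
  rcases hak with h | h
  · exact ⟨leftIdx k, mem_uIcc.2 (Or.inr ⟨hk.1.le, h⟩)⟩
  · exact ⟨rightIdx k, mem_uIcc.2 (Or.inl ⟨h, hk.2.le⟩)⟩

theorem norm_weight_sub_le (lam : ℂ) (a b : Fin (2 * m) → ℝ) (y : ℝ) :
    ‖weight lam b y - weight lam a y‖ ≤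
      ∑ j, (uIcc (a j) (b j)).indicator (fun _ => ‖lam‖) y := by
  have hnn : ∀ j, 0 ≤ (uIcc (a j) (b j)).indicator (fun _ => ‖lam‖) y :=
    fun j => indicator_nonneg (fun _ _ => norm_nonneg _) _
  have key : (∃ j, y ∈ uIcc (a j) (b j)) →
      ‖lam‖ ≤ ∑ j, (uIcc (a j) (b j)).indicator (fun _ => ‖lam‖) y := by
    rintro ⟨j, hj⟩
    have h := Finset.single_le_sum (fun i _ => hnn i) (Finset.mem_univ j)
    rwa [indicator_of_mem hj] at h
  by_cases hb : y ∈ intervals b <;> by_cases ha : y ∈ intervals a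
  · simpa [weight, ha, hb] using Finset.sum_nonneg fun j _ => hnn j
  · simpa [weight, ha, hb] using key (mem_uIcc_of_mem_intervals hb ha)
  · obtain ⟨j, hj⟩ := mem_uIcc_of_mem_intervals ha hb
    simpa [weight, ha, hb] using key ⟨j, uIcc_comm (b j) (a j) ▸ hj⟩
  · simpa [weight, ha, hb] using Finset.sum_nonneg fun j _ => hnn j

/-- The weight depends on the endpoints in a Lipschitz way, in the norm of `L¹`. -/
theorem integral_norm_weight_sub_le (lam : ℂ) (a b : Fin (2 * m) → ℝ) :
    ∫ y, ‖weight lam b y - weight lam a y‖ ≤ 2 * m * ‖lam‖ * ‖b - a‖ := by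
  have hi : ∀ j, Integrable ((uIcc (a j) (b j)).indicator fun _ : ℝ => ‖lam‖) := fun j => by
    rw [integrable_indicator_iff measurableSet_uIcc]
    exact integrableOn_const isCompact_uIcc.measure_lt_top.ne
  calc ∫ y, ‖weight lam b y - weight lam a y‖
      ≤ ∫ y, ∑ j, (uIcc (a j) (b j)).indicator (fun _ => ‖lam‖) y :=
        integral_mono ((integrable_weight lam b).sub (integrable_weight lam a)).norm
          (integrable_finsetSum _ fun j _ => hi j) (norm_weight_sub_le lam a b)
    _ = ∑ j, |b j - a j| * ‖lam‖ := by
        rw [integral_finsetSum _ fun j _ => hi j]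
        refine Finset.sum_congr rfl fun j _ => ?_
        rw [integral_indicator measurableSet_uIcc, setIntegral_const, measureReal_def,
          Real.volume_interval, ENNReal.toReal_ofReal (abs_nonneg _), smul_eq_mul]
    _ ≤ ∑ _j : Fin (2 * m), ‖b - a‖ * ‖lam‖ := by
        gcongr with j
        exact norm_le_pi_norm (b - a) j
    _ = _ := by
        simp
        ring

/-- The weight `λ χ_I` as an element of `L¹`. -/
def weightL1 (lam : ℂ) (a : Fin (2 * m) → ℝ) : ℝ →₁[volume] ℂ := (integrable_weight lam a).toL1

theorem coeFn_weightL1 (lam : ℂ) (a : Fin (2 * m) → ℝ) :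
    weightL1 lam a =ᵐ[volume] weight lam a := (integrable_weight lam a).coeFn_toL1

theorem norm_weightL1_sub_le (lam : ℂ) (a b : Fin (2 * m) → ℝ) :
    ‖weightL1 lam b - weightL1 lam a‖ ≤ 2 * m * ‖lam‖ * ‖b - a‖ := by
  rw [weightL1, weightL1, ← Integrable.toL1_sub, L1.norm_of_fun_eq_integral_norm]
  exact integral_norm_weight_sub_le lam a b

section congr

variable {w w' : ℝ → ℂ}

theorem ae_prod_eq (h : w =ᵐ[volume] w') (n : ℕ) :
    ∀ᵐ X : Fin n → ℝ, ∏ i, w (X i) = ∏ i, w' (X i) := by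
  filter_upwards [ae_all_iff.2 fun i : Fin n => ae_eval i h] with X hX
  exact Finset.prod_congr rfl fun i _ => hX i

/-- Needed to pass between the function `weight lam a` and its class in L¹, whose representative is
determined only almost everywhere. -/
theorem weightedDet_congr (h : w =ᵐ[volume] w') : weightedDet w = weightedDet w' := by
  unfold weightedDet
  refine tsum_congr fun n => congrArg _ (integral_congr_ae ?_)
  filter_upwards [ae_prod_eq h n] with X hX
  rw [hX]

theorem weightedMinor_congr (h : w =ᵐ[volume] w') : weightedMinor w = weightedMinor w' := by
  funext x y
  unfold weightedMinor
  refine tsum_congr fun n => congrArg _ (integral_congr_ae ?_)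
  filter_upwards [ae_prod_eq h n] with X hX
  rw [hX]

end congr

/-- The weight at `X j` is a common factor of the `j`-th column, so the determinant of the kernel is
the determinant of sine kernels times the product of the weights. -/
theorem fredholmDet_eq (lam : ℂ) (a : Fin (2 * m) → ℝ) :
    fredholmDet lam a = weightedDet (weight lam a) := by
  unfold fredholmDet weightedDet
  refine tsum_congr fun n => congrArg _ (integral_congr_ae (Eventually.of_forall fun X => ?_))
  have h1 : (Matrix.of fun i j : Fin n => kernel lam a (X i) (X j)) =
      Matrix.of fun i j : Fin n => weight lam a (X j) *
        (Matrix.of fun i j : Fin n => sineKernel (X i) (X j)).map Complex.ofReal i j := by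
    ext i j
    simp [kernel_eq, mul_comm]
  simp only
  rw [h1, Matrix.det_mul_row, mul_comm, kerDet]
  congr 1
  exact (Complex.ofRealHom.map_det _).symm

/-- A chain rule for a map `φ` that is only Lipschitz at `a`, but whose image under the outer
derivative is differentiable. -/
theorem hasFDerivAt_comp_of_lipschitz {E V G : Type*} [NormedAddCommGroup E] [NormedSpace ℝ E]
    [NormedAddCommGroup V] [NormedSpace ℂ V] [NormedAddCommGroup G] [NormedSpace ℂ G]
    {Φ : V → G} {Φ' : V →L[ℂ] G} {φ : E → V} {a : E} {L : E →L[ℝ] G} {C : ℝ}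
    (hΦ : HasFDerivAt Φ Φ' (φ a)) (hφ : ∀ b, ‖φ b - φ a‖ ≤ C * ‖b - a‖)
    (h : HasFDerivAt (fun b => Φ' (φ b)) L a) : HasFDerivAt (fun b => Φ (φ b)) L a := by
  have hO : (fun b => φ b - φ a) =O[𝓝 a] fun b => b - a :=
    Asymptotics.IsBigO.of_bound C (Eventually.of_forall hφ)
  have hc : Tendsto φ (𝓝 a) (𝓝 (φ a)) := by
    have h0 : Tendsto (fun b : E => b - a) (𝓝 a) (𝓝 0) := by
      have h : Continuous fun b : E => b - a := by fun_prop
      simpa using h.tendsto a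
    exact tendsto_sub_nhds_zero_iff.1 (hO.trans_tendsto h0)
  -- The remainder of Φ is o(φ b - φ a), hence o(b - a) by the Lipschitz bound; the linear part Φ'(φ
  -- b) is differentiable by hypothesis.
  have h1 := (hΦ.isLittleO.comp_tendsto hc).trans_isBigO hO
  refine HasFDerivAt.of_isLittleO ((h1.add h.isLittleO).congr_left fun b => ?_)
  simp only [map_sub, Function.comp_apply]
  abel

/-- The derivative of the Fredholm determinant with respect to the endpoints. -/
theorem Admissible.hasFDerivAt_fredholmDet (lam : ℂ) {a : Fin (2 * m) → ℝ} (ha : Admissible a) :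
    HasFDerivAt (fredholmDet lam)
      (-endpointForm fun j => lam * weightedMinor (weight lam a) (a j) (a j)) a := by
  obtain ⟨F, hF, hF'⟩ := exists_hasFDerivAt_weightedDet (weightL1 lam a)
  have hdet : (fun b : Fin (2 * m) → ℝ => fredholmDet lam b) =
      fun b => weightedDet (weightL1 lam b) := funext fun b => by
    rw [fredholmDet_eq, weightedDet_congr (coeFn_weightL1 lam b)]
  have hFb : (fun b : Fin (2 * m) → ℝ => F (weightL1 lam b)) = fun b =>
      -∫ y in intervals b, lam * weightedMinor (weight lam a) y y := funext fun b => by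
    rw [hF', weightedMinor_congr (coeFn_weightL1 lam a), ← integral_mul_weight]
    congr 1
    refine integral_congr_ae ?_
    filter_upwards [coeFn_weightL1 lam b] with y hy
    rw [hy]
  have hN := (continuous_weightedMinor (integrable_weight lam a)).comp
    (by fun_prop : Continuous fun y : ℝ => (y, y))
  have hg : Continuous fun y => lam * weightedMinor (weight lam a) y y :=
    continuous_const.mul hN
  have h1 : HasFDerivAt (fun b : Fin (2 * m) → ℝ => F (weightL1 lam b))
      (-endpointForm fun j => lam * weightedMinor (weight lam a) (a j) (a j)) a := by
    rw [hFb]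
    exact (ha.hasFDerivAt_integral hg).neg
  have h := hasFDerivAt_comp_of_lipschitz (Φ := fun w : ℝ →₁[volume] ℂ => weightedDet w) hF
    (norm_weightL1_sub_le lam a) h1
  rwa [← hdet] at h

end

/-! ### Inversion of 1 - K and the resolvent kernel -/

section

variable {m : ℕ}

section weightedOp

variable {w : ℝ → ℂ}

theorem norm_boundedKernel_mul_le (G : ℝ × ℝ →ᵇ ℂ) (f : ℝ →ᵇ ℂ) (x y : ℝ) :
    ‖G (x, y) * f y‖ ≤ ‖G‖ * ‖f‖ := by
  rw [norm_mul]
  exact mul_le_mul (G.norm_coe_le_norm _) (f.norm_coe_le_norm _) (norm_nonneg _) (norm_nonneg _)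

theorem integrable_boundedKernel (G : ℝ × ℝ →ᵇ ℂ) (hw : Integrable w) (f : ℝ →ᵇ ℂ) (x : ℝ) :
    Integrable fun y => G (x, y) * f y * w y :=
  hw.bdd_mul ((G.continuous.comp (by fun_prop : Continuous fun y : ℝ => (x, y))).mul
    f.continuous).aestronglyMeasurable
    (Eventually.of_forall fun y => norm_boundedKernel_mul_le G f x y)

theorem norm_weighted_integrand_le (G : ℝ × ℝ →ᵇ ℂ) (f : ℝ →ᵇ ℂ) (x y : ℝ) :
    ‖G (x, y) * f y * w y‖ ≤ ‖G‖ * ‖f‖ * ‖w y‖ := by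
  rw [norm_mul]
  exact mul_le_mul_of_nonneg_right (norm_boundedKernel_mul_le G f x y) (norm_nonneg _)

/-- The integral operator with the bounded continuous kernel `G` and weight `w`. -/
def weightedOp (G : ℝ × ℝ →ᵇ ℂ) (hw : Integrable w) : (ℝ →ᵇ ℂ) →L[ℂ] (ℝ →ᵇ ℂ) :=
  have hb : ∀ (f : ℝ →ᵇ ℂ) (x : ℝ),
      ‖∫ y, G (x, y) * f y * w y‖ ≤ ‖G‖ * (∫ y, ‖w y‖) * ‖f‖ := fun f x => by
    refine (norm_integral_le_of_norm_le (hw.norm.const_mul (‖G‖ * ‖f‖))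
      (Eventually.of_forall fun y => norm_weighted_integrand_le G f x y)).trans_eq ?_
    rw [integral_const_mul]
    ring
  LinearMap.mkContinuous
    { toFun := fun f => BoundedContinuousFunction.ofNormedAddCommGroup
        (fun x => ∫ y, G (x, y) * f y * w y)
        (continuous_of_dominated
          (fun x => (integrable_boundedKernel G hw f x).aestronglyMeasurable)
          (fun x => Eventually.of_forall fun y => norm_weighted_integrand_le G f x y)
          (hw.norm.const_mul _)
          (Eventually.of_forall fun y => ((G.continuous.comp
            (by fun_prop : Continuous fun x : ℝ => (x, y))).mul continuous_const).mul
              continuous_const))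
        (‖G‖ * (∫ y, ‖w y‖) * ‖f‖) (hb f)
      map_add' := fun f g => by
        ext x
        have h := integral_add (integrable_boundedKernel G hw f x)
          (integrable_boundedKernel G hw g x)
        simpa [mul_add, add_mul] using h
      map_smul' := fun c f => by
        ext x
        have h := integral_const_mul (μ := volume) c (fun y => G (x, y) * f y * w y)
        simpa [mul_left_comm, mul_assoc] using h }
    (‖G‖ * ∫ y, ‖w y‖)
    (fun f => (BoundedContinuousFunction.norm_le (mul_nonneg (mul_nonneg (norm_nonneg _)
      (integral_nonneg fun _ => norm_nonneg _)) (norm_nonneg _))).2 (hb f))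

theorem weightedOp_apply (G : ℝ × ℝ →ᵇ ℂ) (hw : Integrable w) (f : ℝ →ᵇ ℂ) (x : ℝ) :
    weightedOp G hw f x = ∫ y, G (x, y) * f y * w y := rfl

theorem weightedOp_sub_smul (G H : ℝ × ℝ →ᵇ ℂ) (c : ℂ) (hw : Integrable w) :
    weightedOp (G - c • H) hw = weightedOp G hw - c • weightedOp H hw := by
  ext f x
  have h := integral_sub (integrable_boundedKernel G hw f x)
    ((integrable_boundedKernel H hw f x).const_mul c)
  rw [integral_const_mul] at h
  simp only [sub_apply, smul_apply,
    BoundedContinuousFunction.coe_sub, BoundedContinuousFunction.coe_smul, Pi.sub_apply,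
    weightedOp_apply, smul_eq_mul]
  rw [← h]
  refine integral_congr_ae (Eventually.of_forall fun y => ?_)
  simp only
  ring

/-- Composition of integral operators corresponds to composition of kernels. -/
theorem weightedOp_mul_weightedOp {G H L : ℝ × ℝ →ᵇ ℂ} (hw : Integrable w)
    (hL : ∀ x y, L (x, y) = ∫ z, G (x, z) * w z * H (z, y)) :
    weightedOp G hw * weightedOp H hw = weightedOp L hw := by
  ext f x
  have hi : Integrable (fun p : ℝ × ℝ => (G (x, p.1) * (H p * f p.2)) * (w p.1 * w p.2))
      (volume.prod volume) := by
    refine (hw.mul_prod hw).bdd_mul (c := ‖G‖ * (‖H‖ * ‖f‖)) (Continuous.aestronglyMeasurable ?_)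
      (Eventually.of_forall fun p => ?_)
    · exact (G.continuous.comp (by fun_prop : Continuous fun p : ℝ × ℝ => (x, p.1))).mul
        (H.continuous.mul (f.continuous.comp continuous_snd))
    · rw [norm_mul]
      exact mul_le_mul (G.norm_coe_le_norm _) (norm_boundedKernel_mul_le H f p.1 p.2)
        (norm_nonneg _) (norm_nonneg _)
  calc ∫ z, G (x, z) * (∫ y, H (z, y) * f y * w y) * w z
      = ∫ z, ∫ y, (G (x, z) * (H (z, y) * f y)) * (w z * w y) := by
        refine integral_congr_ae (Eventually.of_forall fun z => ?_)
        simp only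
        rw [mul_right_comm, ← integral_const_mul]
        refine integral_congr_ae (Eventually.of_forall fun y => ?_)
        simp only
        ring
    _ = ∫ y, ∫ z, (G (x, z) * (H (z, y) * f y)) * (w z * w y) := integral_integral_swap hi
    _ = ∫ y, L (x, y) * f y * w y := by
        refine integral_congr_ae (Eventually.of_forall fun y => ?_)
        simp only
        rw [hL, mul_assoc, ← integral_mul_const]
        refine integral_congr_ae (Eventually.of_forall fun z => ?_)
        simp only
        ring

/-- The sine kernel as a bounded continuous function of two variables. -/
def sineKernelBdd : ℝ × ℝ →ᵇ ℂ :=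
  BoundedContinuousFunction.ofNormedAddCommGroup (fun p : ℝ × ℝ => (sineKernel p.1 p.2 : ℂ))
    (Complex.continuous_ofReal.comp continuous_sineKernel) 1 fun p => by
      rw [Complex.norm_real]
      exact abs_sineKernel_le_one p.1 p.2

/-- The first Fredholm minor as a bounded continuous function of two variables. -/
def minorBdd (hw : Integrable w) : ℝ × ℝ →ᵇ ℂ :=
  BoundedContinuousFunction.ofNormedAddCommGroup (fun p : ℝ × ℝ => weightedMinor w p.1 p.2)
    (continuous_weightedMinor hw) _ fun p => norm_weightedMinor_le hw p.1 p.2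

theorem sineOp_mul_minorOp (hw : Integrable w) :
    weightedOp sineKernelBdd hw * weightedOp (minorBdd hw) hw =
      weightedOp (minorBdd hw) hw - weightedDet w • weightedOp sineKernelBdd hw := by
  rw [← weightedOp_sub_smul]
  refine weightedOp_mul_weightedOp hw fun x y => ?_
  change weightedMinor w x y - weightedDet w * sineKernel x y =
    ∫ z, sineKernel x z * w z * weightedMinor w z y
  rw [weightedMinor_eq hw]
  ring

theorem minorOp_mul_sineOp (hw : Integrable w) :
    weightedOp (minorBdd hw) hw * weightedOp sineKernelBdd hw =
      weightedOp (minorBdd hw) hw - weightedDet w • weightedOp sineKernelBdd hw := by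
  rw [← weightedOp_sub_smul]
  refine weightedOp_mul_weightedOp hw fun x y => ?_
  change weightedMinor w x y - weightedDet w * sineKernel x y =
    ∫ z, weightedMinor w x z * w z * sineKernel z y
  rw [weightedMinor_comm, weightedMinor_eq hw, sineKernel_comm x y, mul_comm (weightedDet w),
    add_sub_cancel_left]
  refine integral_congr_ae (Eventually.of_forall fun z => ?_)
  simp only [weightedMinor_comm x z, sineKernel_comm z y]
  ring

/-- With N the operator of the first minor, KN = NK = N - DK, so 1 + D⁻¹N is a two-sided inverse. -/
theorem isUnit_one_sub_weightedOp (hw : Integrable w) (hD : weightedDet w ≠ 0) :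
    IsUnit (1 - weightedOp sineKernelBdd hw) := by
  set K := weightedOp sineKernelBdd hw
  set N := weightedOp (minorBdd hw) hw
  have e1 : K * ((weightedDet w)⁻¹ • N) = (weightedDet w)⁻¹ • (K * N) :=
    ContinuousLinearMap.ext fun f => map_smul K _ _
  have e2 : ((weightedDet w)⁻¹ • N) * K = (weightedDet w)⁻¹ • (N * K) := rfl
  have h1 : (1 - K) * (1 + (weightedDet w)⁻¹ • N) = 1 := by
    rw [sub_mul, one_mul, mul_add, mul_one, e1, sineOp_mul_minorOp, smul_sub,
      inv_smul_smul₀ hD]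
    abel
  have h2 : (1 + (weightedDet w)⁻¹ • N) * (1 - K) = 1 := by
    rw [mul_sub, mul_one, add_mul, one_mul, e2, minorOp_mul_sineOp, smul_sub,
      inv_smul_smul₀ hD]
    abel
  exact ⟨⟨_, _, h1, h2⟩, rfl⟩

end weightedOp

theorem sineOp_eq_weightedOp (lam : ℂ) (a : Fin (2 * m) → ℝ) :
    sineOp lam a = weightedOp sineKernelBdd (integrable_weight lam a) := by
  ext f x
  rw [sineOp_apply, weightedOp_apply]
  refine integral_congr_ae (Eventually.of_forall fun y => ?_)
  simp only [kernel_eq]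
  exact mul_right_comm _ _ _

theorem isUnit_one_sub_sineOp {lam : ℂ} {a : Fin (2 * m) → ℝ} (hD : fredholmDet lam a ≠ 0) :
    IsUnit (1 - sineOp lam a) := by
  rw [sineOp_eq_weightedOp]
  exact isUnit_one_sub_weightedOp _ (fredholmDet_eq lam a ▸ hD)

section inverse

variable {lam : ℂ} {a : Fin (2 * m) → ℝ}

theorem invOp_eq_of_sub_sineOp_eq (hu : IsUnit (1 - sineOp lam a)) {f g : ℝ →ᵇ ℂ}
    (h : f - sineOp lam a f = g) : invOp lam a g = f := by
  have h1 : invOp lam a * (1 - sineOp lam a) = 1 := Ring.inverse_mul_cancel _ hu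
  rw [← h]
  exact congrArg (fun T : (ℝ →ᵇ ℂ) →L[ℂ] (ℝ →ᵇ ℂ) => T f) h1

theorem invOp_sub_sineOp_invOp (hu : IsUnit (1 - sineOp lam a)) (f : ℝ →ᵇ ℂ) :
    invOp lam a f - sineOp lam a (invOp lam a f) = f := by
  have h1 : (1 - sineOp lam a) * invOp lam a = 1 := Ring.mul_inverse_cancel _ hu
  exact congrArg (fun T : (ℝ →ᵇ ℂ) →L[ℂ] (ℝ →ᵇ ℂ) => T f) h1

theorem invOp_sineOp (hu : IsUnit (1 - sineOp lam a)) (f : ℝ →ᵇ ℂ) :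
    invOp lam a (sineOp lam a f) = invOp lam a f - f := by
  have h := invOp_eq_of_sub_sineOp_eq hu (f := f) rfl
  rw [map_sub] at h
  rw [← sub_eq_iff_eq_add.2 (sub_eq_iff_eq_add'.1 h)]

end inverse

/-- The column `x ↦ K(x, y)` of the sine kernel. -/
def sineColumn (y : ℝ) : ℝ →ᵇ ℂ :=
  BoundedContinuousFunction.ofNormedAddCommGroup (fun x => (sineKernel x y : ℂ))
    (Complex.continuous_ofReal.comp
      (continuous_sineKernel.comp (by fun_prop : Continuous fun x : ℝ => (x, y)))) 1
    fun x => by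
      rw [Complex.norm_real]
      exact abs_sineKernel_le_one x y

theorem sineColumn_apply (x y : ℝ) : sineColumn y x = sineKernel x y := rfl

theorem abs_sinc_le_inv_abs {x : ℝ} (hx : x ≠ 0) : |Real.sinc x| ≤ |x|⁻¹ := by
  rw [Real.sinc_of_ne_zero hx, abs_div, div_eq_mul_inv]
  exact mul_le_of_le_one_left (inv_nonneg.2 (abs_nonneg x)) (Real.abs_sin_le_one x)

/-- Decay at infinity upgrades continuity to uniform continuity. This makes y ↦ K(·, y) continuous
in the supremum norm, so that K can be written as a Bochner integral of columns. -/
theorem uniformContinuous_sinc : UniformContinuous Real.sinc := by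
  refine Real.continuous_sinc.uniformContinuous_of_tendsto_cocompact (x := 0) ?_
  have h1 : Tendsto (fun x : ℝ => |x|⁻¹) (cocompact ℝ) (𝓝 0) :=
    tendsto_inv_atTop_zero.comp (tendsto_norm_cocompact_atTop (E := ℝ))
  refine squeeze_zero_norm' ?_ h1
  have h0 : ∀ᶠ x : ℝ in cocompact ℝ, x ≠ 0 := by
    simpa using (isCompact_singleton (x := (0 : ℝ))).compl_mem_cocompact
  exact h0.mono fun x hx => abs_sinc_le_inv_abs hx

theorem continuous_sineColumn : Continuous sineColumn := by
  rw [Metric.continuous_iff]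
  intro y ε hε
  obtain ⟨δ, hδ, h⟩ := Metric.uniformContinuous_iff.1 uniformContinuous_sinc (ε / 2) (half_pos hε)
  refine ⟨δ / Real.pi, div_pos hδ Real.pi_pos, fun z hz => ?_⟩
  refine lt_of_le_of_lt ?_ (half_lt_self hε)
  refine (BoundedContinuousFunction.dist_le (half_pos hε).le).2 fun x => ?_
  rw [sineColumn_apply, sineColumn_apply, Complex.isometry_ofReal.dist_eq]
  refine (h ?_).le
  rw [Real.dist_eq] at hz ⊢
  rw [show Real.pi * (x - z) - Real.pi * (x - y) = -(Real.pi * (z - y)) by ring, abs_neg, abs_mul,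
    abs_of_pos Real.pi_pos, mul_comm]
  exact (lt_div_iff₀ Real.pi_pos).1 hz

theorem continuous_smul_sineColumn (lam : ℂ) (f : ℝ →ᵇ ℂ) :
    Continuous fun y => (lam * f y) • sineColumn y :=
  (continuous_const.mul f.continuous).smul continuous_sineColumn

/-- The operator `K` as a Bochner integral of columns. -/
theorem sineOp_eq_integral (lam : ℂ) (a : Fin (2 * m) → ℝ) (f : ℝ →ᵇ ℂ) :
    sineOp lam a f = ∫ y in intervals a, (lam * f y) • sineColumn y := by
  ext x
  have h := (BoundedContinuousFunction.evalCLM ℂ x).integral_comp_comm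
    (integrableOn_intervals (continuous_smul_sineColumn lam f) a)
  refine Eq.trans ?_ h
  rw [sineOp_apply, ← integral_indicator (measurableSet_intervals a)]
  refine integral_congr_ae (Eventually.of_forall fun y => ?_)
  by_cases hy : y ∈ intervals a
  · simp [kernel, hy, sineColumn_apply, mul_right_comm]
  · simp [kernel, hy]

/-- The continuous extension of the resolvent kernel from `ℝ × I` to `ℝ × ℝ`. -/
def resolvent (lam : ℂ) (a : Fin (2 * m) → ℝ) (x y : ℝ) : ℂ := lam * invOp lam a (sineColumn y) x

/-- The continuous functional f ↦ ((1 - K)⁻¹ f)(x) may be taken inside the Bochner integral of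
columns. -/
theorem invOp_sineOp_apply (lam : ℂ) (a : Fin (2 * m) → ℝ) (f : ℝ →ᵇ ℂ) (x : ℝ) :
    invOp lam a (sineOp lam a f) x = ∫ y in intervals a, resolvent lam a x y * f y := by
  have h := ((BoundedContinuousFunction.evalCLM ℂ x).comp (invOp lam a)).integral_comp_comm
    (integrableOn_intervals (continuous_smul_sineColumn lam f) a)
  rw [← sineOp_eq_integral] at h
  refine h.symm.trans (integral_congr_ae (Eventually.of_forall fun y => ?_))
  simp [resolvent, mul_right_comm]

theorem resolventKernel_of_mem {lam : ℂ} {a : Fin (2 * m) → ℝ} {y : ℝ} (hy : y ∈ intervals a)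
    (x : ℝ) : resolventKernel lam a x y = resolvent lam a x y := by
  have h : kernelColumn lam a y = lam • sineColumn y := by
    ext x
    simp [kernelColumn, kernel, hy, sineColumn_apply]
  simp [resolventKernel, resolvent, h]

theorem resolventKernel_of_notMem {lam : ℂ} {a : Fin (2 * m) → ℝ} {y : ℝ} (hy : y ∉ intervals a)
    (x : ℝ) : resolventKernel lam a x y = 0 := by
  have h : kernelColumn lam a y = 0 := by
    ext x
    simp [kernelColumn, kernel, hy]
  simp [resolventKernel, h]

theorem invOp_sineOp_apply_eq_integral (lam : ℂ) (a : Fin (2 * m) → ℝ) (f : ℝ →ᵇ ℂ) (x : ℝ) :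
    invOp lam a (sineOp lam a f) x = ∫ y, resolventKernel lam a x y * f y := by
  rw [invOp_sineOp_apply, ← integral_indicator (measurableSet_intervals a)]
  refine integral_congr_ae (Eventually.of_forall fun y => ?_)
  by_cases hy : y ∈ intervals a
  · simp [hy, resolventKernel_of_mem hy]
  · simp [hy, resolventKernel_of_notMem hy]

/-- The resolvent as a quotient of Fredholm's entire functions. -/
theorem resolvent_eq {lam : ℂ} {a : Fin (2 * m) → ℝ} (hD : fredholmDet lam a ≠ 0) (x y : ℝ) :
    resolvent lam a x y = lam * weightedMinor (weight lam a) x y / fredholmDet lam a := by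
  let N : ℝ →ᵇ ℂ := (minorBdd (integrable_weight lam a)).compContinuous
    ⟨fun x : ℝ => (x, y), by fun_prop⟩
  -- By the first Fredholm identity, the column of the minor solves (1 - K)N = D K(·, y).
  have hN : N - sineOp lam a N = fredholmDet lam a • sineColumn y := by
    ext x
    change weightedMinor (weight lam a) x y -
      ∫ z, kernel lam a x z * weightedMinor (weight lam a) z y =
        fredholmDet lam a * sineKernel x y
    simp only [kernel_eq]
    rw [weightedMinor_eq (integrable_weight lam a), fredholmDet_eq]
    ring
  have h := invOp_eq_of_sub_sineOp_eq (isUnit_one_sub_sineOp hD) hN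
  have h2 : fredholmDet lam a * invOp lam a (sineColumn y) x = weightedMinor (weight lam a) x y := by
    have h3 := congrArg (fun f : ℝ →ᵇ ℂ => f x) h
    simp only [map_smul, BoundedContinuousFunction.coe_smul, smul_eq_mul] at h3
    exact h3
  rw [resolvent, ← h2]
  field_simp

theorem resolvent_comm {lam : ℂ} {a : Fin (2 * m) → ℝ} (hD : fredholmDet lam a ≠ 0) (x y : ℝ) :
    resolvent lam a x y = resolvent lam a y x := by
  rw [resolvent_eq hD, resolvent_eq hD, weightedMinor_comm]

theorem continuous_resolvent {lam : ℂ} {a : Fin (2 * m) → ℝ} (hD : fredholmDet lam a ≠ 0) :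
    Continuous fun p : ℝ × ℝ => resolvent lam a p.1 p.2 := by
  simp only [resolvent_eq hD]
  exact (continuous_const.mul (continuous_weightedMinor (integrable_weight lam a))).div_const _

end

/-! ### Derivatives of (1 - K)⁻¹ f in the endpoints and under translation -/

section

variable {m : ℕ} {lam : ℂ} {a : Fin (2 * m) → ℝ}

theorem norm_sineOp_sub_le (lam : ℂ) (a b : Fin (2 * m) → ℝ) :
    ‖sineOp lam b - sineOp lam a‖ ≤ 2 * m * ‖lam‖ * ‖b - a‖ := by
  refine ContinuousLinearMap.opNorm_le_bound _ (by positivity) fun f => ?_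
  refine (BoundedContinuousFunction.norm_le (by positivity)).2 fun x => ?_
  have hi : Integrable fun y => ‖weight lam b y - weight lam a y‖ :=
    ((integrable_weight lam b).sub (integrable_weight lam a)).norm
  have h : (sineOp lam b - sineOp lam a) f x =
      ∫ y, sineKernel x y * (weight lam b y - weight lam a y) * f y := by
    rw [sub_apply, BoundedContinuousFunction.sub_apply, sineOp_apply, sineOp_apply,
      ← integral_sub (integrable_integrand lam b f x) (integrable_integrand lam a f x)]
    refine integral_congr_ae (Eventually.of_forall fun y => ?_)
    simp only [kernel_eq]
    ring
  rw [h]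
  refine (norm_integral_le_of_norm_le (hi.mul_const ‖f‖) (Eventually.of_forall fun y => ?_)).trans ?_
  · rw [norm_mul, norm_mul, Complex.norm_real]
    exact mul_le_mul (mul_le_of_le_one_left (norm_nonneg _) (abs_sineKernel_le_one x y))
      (f.norm_coe_le_norm y) (norm_nonneg _) (norm_nonneg _)
  · rw [integral_mul_const]
    exact mul_le_mul_of_nonneg_right (integral_norm_weight_sub_le lam a b) (norm_nonneg _)

theorem continuous_sineOp (lam : ℂ) : Continuous fun a : Fin (2 * m) → ℝ => sineOp lam a := by
  refine continuous_iff_continuousAt.2 fun a => ?_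
  refine tendsto_iff_norm_sub_tendsto_zero.2 (squeeze_zero (fun _ => norm_nonneg _)
    (norm_sineOp_sub_le lam a) ?_)
  have h : Continuous fun b : Fin (2 * m) → ℝ => 2 * m * ‖lam‖ * ‖b - a‖ := by fun_prop
  simpa using h.tendsto a

theorem eventually_isUnit (hu : IsUnit (1 - sineOp lam a)) :
    ∀ᶠ b : Fin (2 * m) → ℝ in 𝓝 a, IsUnit (1 - sineOp lam b) := by
  have hc : ContinuousAt (fun b : Fin (2 * m) → ℝ => 1 - sineOp lam b) a :=
    (continuous_const.sub (continuous_sineOp lam)).continuousAt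
  exact hc.eventually ((Units.isOpen (R := (ℝ →ᵇ ℂ) →L[ℂ] (ℝ →ᵇ ℂ))).mem_nhds hu)

theorem continuousAt_invOp (hu : IsUnit (1 - sineOp lam a)) :
    ContinuousAt (fun b : Fin (2 * m) → ℝ => invOp lam b) a := by
  obtain ⟨u, hu⟩ := hu
  have h := NormedRing.inverse_continuousAt (R := (ℝ →ᵇ ℂ) →L[ℂ] (ℝ →ᵇ ℂ)) u
  rw [hu] at h
  exact ContinuousAt.comp (f := fun b : Fin (2 * m) → ℝ => 1 - sineOp lam b) h
    (continuous_const.sub (continuous_sineOp lam)).continuousAt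

/-- If `S` is continuous at `a` and `v` is differentiable with `v a = 0`, then `S b (v b)` is
differentiable at `a`. -/
theorem hasFDerivAt_apply_of_continuousAt {E V W : Type*} [NormedAddCommGroup E] [NormedSpace ℝ E]
    [NormedAddCommGroup V] [NormedSpace ℂ V] [NormedAddCommGroup W] [NormedSpace ℂ W]
    {S : E → V →L[ℂ] W} {v : E → V} {v' : E →L[ℝ] V} {a : E} (hS : ContinuousAt S a)
    (hv : HasFDerivAt v v' a) (hva : v a = 0) :
    HasFDerivAt (fun b => S b (v b)) (((S a).restrictScalars ℝ).comp v') a := by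
  -- The error splits as S_a(v(b) - v'(b - a)) + (S_b - S_a) v(b). In the second term the first
  -- factor is o(1) and, because v(a) = 0, the second is O(b - a); no differentiability of S is
  -- required.
  have h1 : (fun b => (S a).restrictScalars ℝ (v b - v' (b - a))) =o[𝓝 a] fun b => b - a := by
    have h := hv.isLittleO
    simp only [hva, sub_zero] at h
    exact ((S a).restrictScalars ℝ).isBigO_comp _ _ |>.trans_isLittleO h
  have h2 : (fun b => (S b - S a) (v b)) =o[𝓝 a] fun b => b - a := by
    have hO : v =O[𝓝 a] fun b => b - a := by simpa [hva] using hv.isBigO_sub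
    have h0 : (fun b => S b - S a) =o[𝓝 a] fun _ => (1 : ℝ) :=
      (Asymptotics.isLittleO_one_iff ℝ).2 (tendsto_sub_nhds_zero_iff.2 hS)
    have h3 : (fun b => (S b - S a) (v b)) =O[𝓝 a] fun b => ‖S b - S a‖ * ‖v b‖ :=
      Asymptotics.IsBigO.of_bound 1 (Eventually.of_forall fun b => by
        simpa using (S b - S a).le_opNorm (v b))
    refine h3.trans_isLittleO ?_
    simpa using (h0.norm_left.mul_isBigO hO.norm_norm).norm_right
  refine HasFDerivAt.of_isLittleO ((h1.add h2).congr_left fun b => ?_)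
  simp [hva]

/-- The derivative of `(1 - K)⁻¹ f` with respect to the endpoints, in the space of bounded
continuous functions. -/
theorem hasFDerivAt_invOp (ha : Admissible a) (hu : IsUnit (1 - sineOp lam a)) (f : ℝ →ᵇ ℂ) :
    HasFDerivAt (fun b : Fin (2 * m) → ℝ => invOp lam b f)
      (((invOp lam a).restrictScalars ℝ).comp
        (endpointForm fun j => (lam * invOp lam a f (a j)) • sineColumn (a j))) a := by
  set g := invOp lam a f with hg
  have h1 : HasFDerivAt (fun b : Fin (2 * m) → ℝ => sineOp lam b g - sineOp lam a g)
      (endpointForm fun j => (lam * g (a j)) • sineColumn (a j)) a := by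
    refine HasFDerivAt.sub_const _ ?_
    simp only [sineOp_eq_integral]
    exact ha.hasFDerivAt_integral (continuous_smul_sineColumn lam g)
  have h2 := (hasFDerivAt_apply_of_continuousAt (continuousAt_invOp hu) h1 (sub_self _)).const_add g
  refine h2.congr_of_eventuallyEq ((eventually_isUnit hu).mono fun b hb => ?_)
  have e : f = g - sineOp lam a g := (invOp_sub_sineOp_invOp hu f).symm
  -- Applying (1 - K_b)⁻¹ to this splitting gives g + (1 - K_b)⁻¹ (K_b g - K_a g), to which
  -- `hasFDerivAt_apply_of_continuousAt` applies.
  have e2 : f = (g - sineOp lam b g) + (sineOp lam b g - sineOp lam a g) := by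
    rw [e]
    abel
  simp only
  conv_lhs => rw [e2]
  rw [map_add, invOp_eq_of_sub_sineOp_eq hb rfl]

theorem hasFDerivAt_invOp_apply (ha : Admissible a) (hu : IsUnit (1 - sineOp lam a)) (f : ℝ →ᵇ ℂ)
    (x : ℝ) : HasFDerivAt (fun b : Fin (2 * m) → ℝ => invOp lam b f x)
      (endpointForm fun j => resolvent lam a x (a j) * invOp lam a f (a j)) a := by
  have h := ((BoundedContinuousFunction.evalCLM ℂ x).restrictScalars ℝ).hasFDerivAt.comp a
    (hasFDerivAt_invOp ha hu f)
  convert! h using 1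
  ext v
  have e : ∀ (r : ℝ) (F : ℝ →ᵇ ℂ), (BoundedContinuousFunction.evalCLM ℂ x) (r • F) = r • F x :=
    fun _ _ => rfl
  rw [endpointForm_apply]
  simp only [ContinuousLinearMap.comp_apply, ContinuousLinearMap.coe_restrictScalars',
    endpointForm_apply]
  rw [map_sum, map_sum]
  refine Finset.sum_congr rfl fun j _ => ?_
  have e1 : ∀ F : ℝ →ᵇ ℂ, invOp lam a (v j • F) = v j • invOp lam a F := fun F =>
    map_smul ((invOp lam a).restrictScalars ℝ) (v j) F
  rw [e1, e, map_smul, map_smul]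
  simp only [BoundedContinuousFunction.coe_smul, smul_eq_mul, resolvent]
  congr 2
  ring

/-- Translation of the argument by `h`. -/
def translate (h : ℝ) (f : ℝ →ᵇ ℂ) : ℝ →ᵇ ℂ := f.compContinuous ⟨fun x => x + h, by fun_prop⟩

theorem translate_apply (h : ℝ) (f : ℝ →ᵇ ℂ) (x : ℝ) : translate h f x = f (x + h) := rfl

theorem add_mem_intervals (b : Fin (2 * m) → ℝ) (h y : ℝ) :
    y + h ∈ intervals b ↔ y ∈ intervals (fun j => b j - h) := by
  simp only [intervals, interval, mem_iUnion, mem_Ioo, leftEnd, rightEnd, sub_lt_iff_lt_add,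
    lt_sub_iff_add_lt]

/-- The sine kernel depends only on x - y, so translation conjugates K into the same operator with
all endpoints shifted by -h. -/
theorem translate_sineOp (lam : ℂ) (b : Fin (2 * m) → ℝ) (h : ℝ) (f : ℝ →ᵇ ℂ) :
    translate h (sineOp lam b f) = sineOp lam (fun j => b j - h) (translate h f) := by
  ext x
  rw [translate_apply, sineOp_apply, sineOp_apply, ← integral_add_right_eq_self _ h]
  refine integral_congr_ae (Eventually.of_forall fun y => ?_)
  have h1 : sineKernel (x + h) (y + h) = sineKernel x y := by
    unfold sineKernel
    congr 2
    ring
  have h2 : weight lam b (y + h) = weight lam (fun j => b j - h) y := by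
    by_cases hy : y ∈ intervals (fun j => b j - h)
    · simp [weight, hy, (add_mem_intervals b h y).2 hy]
    · simp [weight, hy, (add_mem_intervals b h y).not.2 hy]
  simp only [kernel_eq, h1, h2, translate_apply]

theorem translate_invOp {b : Fin (2 * m) → ℝ} {h : ℝ} (hb : IsUnit (1 - sineOp lam b))
    (hbh : IsUnit (1 - sineOp lam fun j => b j - h)) (f : ℝ →ᵇ ℂ) :
    translate h (invOp lam b f) = invOp lam (fun j => b j - h) (translate h f) := by
  refine (invOp_eq_of_sub_sineOp_eq hbh ?_).symm
  rw [← translate_sineOp]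
  conv_rhs => rw [← invOp_sub_sineOp_invOp hb f]
  rfl

/-- The derivative of `(1 - K)⁻¹ f`, for a function `f` with
`f (x + h) = c h * f x + d h * g x`, when the endpoints and the argument move together. -/
theorem hasDerivAt_invOp_along (ha : Admissible a) (hu : IsUnit (1 - sineOp lam a))
    {f g : ℝ →ᵇ ℂ} {c d : ℝ → ℂ} {κ : ℂ} (hc0 : c 0 = 1) (hc : HasDerivAt c 0 0) (hd0 : d 0 = 0)
    (hd : HasDerivAt d κ 0) (hfg : ∀ h, translate h f = c h • f + d h • g)
    {b : ℝ → Fin (2 * m) → ℝ} {v : Fin (2 * m) → ℝ} {x : ℝ} (hb : HasDerivAt b v x)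
    (hbx : b x = a) :
    HasDerivAt (fun t => invOp lam (b t) f t) (κ * invOp lam a g x +
      ∑ j, (v j - 1) * (sgn j * resolvent lam a x (a j) * invOp lam a f (a j))) x := by
  -- Translation by t - x brings the argument back to the fixed point x, at the price of letting
  -- every endpoint move with velocity v_j - 1 and of replacing f by c f + d g.
  have hβ : HasDerivAt (fun t => fun j => b t j - (t - x)) (fun j => v j - 1) x := by
    refine hasDerivAt_pi.2 fun j => ?_
    exact (hasDerivAt_pi.1 hb j).sub ((hasDerivAt_id x).sub_const x)
  have hβx : (fun j => b x j - (x - x)) = a := by simp [hbx]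
  have hF : ∀ F : ℝ →ᵇ ℂ, HasDerivAt (fun t => invOp lam (fun j => b t j - (t - x)) F x)
      (∑ j, (v j - 1) * (sgn j * resolvent lam a x (a j) * invOp lam a F (a j))) x := fun F => by
    have h := HasFDerivAt.comp_hasDerivAt (f := fun t => fun j => b t j - (t - x)) x
      (by rw [hβx]; exact hasFDerivAt_invOp_apply ha hu F x) hβ
    convert! h using 1
    rw [endpointForm_apply]
    refine Finset.sum_congr rfl fun j _ => ?_
    simp [mul_assoc]
  have hsub : HasDerivAt (fun t : ℝ => t - x) 1 x := (hasDerivAt_id x).sub_const x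
  have hc' : HasDerivAt (fun t => c (t - x)) 0 x := by
    have h := HasDerivAt.scomp (h := fun t : ℝ => t - x) x (by simpa using hc) hsub
    rwa [smul_zero] at h
  have hd' : HasDerivAt (fun t => d (t - x)) κ x := by
    have h := HasDerivAt.scomp (h := fun t : ℝ => t - x) x (by simpa using hd) hsub
    rwa [one_smul] at h
  have hmain := (hc'.mul (hF f)).add (hd'.mul (hF g))
  simp only [sub_self, hc0, hd0, one_mul, zero_mul, zero_add, add_zero, sub_zero] at hmain
  rw [hbx] at hmain
  rw [add_comm]
  refine hmain.congr_of_eventuallyEq ?_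
  have hu1 : ∀ᶠ t in 𝓝 x, IsUnit (1 - sineOp lam (b t)) :=
    hb.continuousAt.eventually (by rw [hbx]; exact eventually_isUnit hu)
  have hu2 : ∀ᶠ t in 𝓝 x, IsUnit (1 - sineOp lam fun j => b t j - (t - x)) := by
    have h0 := eventually_isUnit hu
    rw [← hβx] at h0
    exact hβ.continuousAt.eventually h0
  filter_upwards [hu1, hu2] with t h1 h2
  have h3 := congrArg (fun F : ℝ →ᵇ ℂ => F x) (translate_invOp h1 h2 f)
  simp only [translate_apply, add_sub_cancel, hfg, map_add, map_smul] at h3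
  exact h3

end

/-! ### The integrable structure and the Jimbo-Miwa-Môri-Sato equations -/

section

variable {m : ℕ} {lam s : ℂ} {a : Fin (2 * m) → ℝ}

theorem funA_apply (s : ℂ) (x : ℝ) : funA s x = s * ((Real.sin (Real.pi * x) / Real.pi : ℝ) : ℂ) :=
  rfl

theorem funA'_apply (s : ℂ) (x : ℝ) : funA' s x = s * ((Real.cos (Real.pi * x) : ℝ) : ℂ) := rfl

/-- The sine kernel is integrable in the sense of Its, Izergin, Korepin and Slavnov. -/
theorem sub_mul_sineKernel (hs : s ^ 2 = lam) (x y : ℝ) :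
    lam * (((x : ℂ) - y) * sineKernel x y) = funA s x * funA' s y - funA' s x * funA s y := by
  have h : (x - y) * sineKernel x y = Real.sin (Real.pi * x) / Real.pi * Real.cos (Real.pi * y) -
      Real.cos (Real.pi * x) * (Real.sin (Real.pi * y) / Real.pi) := by
    unfold sineKernel
    rcases eq_or_ne x y with rfl | hxy
    · ring
    · have h0 : x - y ≠ 0 := sub_ne_zero.2 hxy
      rw [Real.sinc_of_ne_zero (mul_ne_zero Real.pi_ne_zero h0), mul_sub, Real.sin_sub]
      rw [← mul_sub]
      field_simp
  have h' := congrArg (fun r : ℝ => (r : ℂ)) h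
  push_cast at h'
  rw [h', funA_apply, funA'_apply, funA_apply, funA'_apply, ← hs]
  push_cast
  ring

theorem sineOp_apply_eq_setIntegral (f : ℝ →ᵇ ℂ) (x : ℝ) :
    sineOp lam a f x = ∫ z in intervals a, lam * sineKernel x z * f z := by
  rw [sineOp_apply, ← integral_indicator (measurableSet_intervals a)]
  refine integral_congr_ae (Eventually.of_forall fun z => ?_)
  by_cases hz : z ∈ intervals a <;> simp [kernel, hz]

theorem continuous_sineKernel_right (x : ℝ) : Continuous fun z : ℝ => (sineKernel x z : ℂ) :=
  Complex.continuous_ofReal.comp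
    (continuous_sineKernel.comp (by fun_prop : Continuous fun z : ℝ => (x, z)))

theorem invOp_apply_eq (hu : IsUnit (1 - sineOp lam a)) (f : ℝ →ᵇ ℂ) (y : ℝ) :
    invOp lam a f y = f y + ∫ z in intervals a, resolvent lam a y z * f z := by
  rw [← invOp_sineOp_apply, invOp_sineOp hu, BoundedContinuousFunction.sub_apply]
  ring

/-- The integrable form of the resolvent kernel. -/
theorem sub_mul_resolvent (hs : s ^ 2 = lam) (hD : fredholmDet lam a ≠ 0) (x y : ℝ) :
    ((x : ℂ) - y) * resolvent lam a x y =
      funQ lam s a x * funP lam s a y - funP lam s a x * funQ lam s a y := by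
  have hu := isUnit_one_sub_sineOp hD
  let r : ℝ →ᵇ ℂ := lam • invOp lam a (sineColumn y)
  have hr : ∀ z, r z = resolvent lam a z y := fun z => rfl
  have hrK : ∀ z, r z = lam * sineKernel z y + sineOp lam a r z := fun z => by
    have h := congrArg (fun f : ℝ →ᵇ ℂ => lam * f z) (invOp_sub_sineOp_invOp hu (sineColumn y))
    simp only [BoundedContinuousFunction.sub_apply, sineColumn_apply] at h
    rw [← h]
    simp only [r, map_smul, BoundedContinuousFunction.coe_smul, smul_eq_mul]
    ring
  -- By the symmetry of the resolvent, Q(y) and P(y) are integrals of A and A' against the column r.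
  have hc : ∀ f : ℝ →ᵇ ℂ, invOp lam a f y = f y + ∫ z in intervals a, f z * r z := fun f => by
    rw [invOp_apply_eq hu]
    congr 1
    refine integral_congr_ae (Eventually.of_forall fun z => ?_)
    simp only
    rw [hr, resolvent_comm hD, mul_comm]
  let φ : ℝ → ℂ := fun z => ((z : ℂ) - y) * r z
  have hφc : Continuous φ := by fun_prop
  -- Writing z - y = (z - t) + (t - y) under the integral in (z - y) K r(z), the first part
  -- separates into A and A' and the second reproduces K φ. The outcome is (1 - K)φ = P(y) A - Q(y)
  -- A'.
  have hφ : ∀ z, φ z = funP lam s a y * funA s z - funQ lam s a y * funA' s z +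
      ∫ t in intervals a, lam * sineKernel z t * φ t := by
    intro z
    have i1 := integrableOn_intervals (g := fun t => funA s z * (funA' s t * r t))
      (by fun_prop) a
    have i2 := integrableOn_intervals (g := fun t => funA' s z * (funA s t * r t))
      (by fun_prop) a
    have i3 := integrableOn_intervals
      ((continuous_const.mul (continuous_sineKernel_right z)).mul hφc) a (g := fun t =>
        lam * sineKernel z t * φ t)
    have h1 : ((z : ℂ) - y) * sineOp lam a r z =
        (funA s z * ∫ t in intervals a, funA' s t * r t) -
        (funA' s z * ∫ t in intervals a, funA s t * r t) +
        ∫ t in intervals a, lam * sineKernel z t * φ t := by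
      rw [sineOp_apply_eq_setIntegral, ← integral_const_mul, ← integral_const_mul,
        ← integral_const_mul, ← integral_sub i1 i2]
      refine Eq.trans ?_ (integral_add (i1.sub i2) i3)
      refine integral_congr_ae (Eventually.of_forall fun t => ?_)
      have h := sub_mul_sineKernel hs z t
      simp only [φ]
      linear_combination (r t) * h
    simp only [funP, funQ, hc]
    have h2 := sub_mul_sineKernel hs z y
    change ((z : ℂ) - y) * r z = _
    rw [hrK z]
    linear_combination h1 + h2
  -- The factor z - y is unbounded, so φ is not bounded by definition; its equation bounds it,
  -- because the integral involves φ only on the bounded set I. Only then may (1 - K)⁻¹ be applied.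
  have hb : ∀ z, ‖φ z‖ ≤ ‖funP lam s a y • funA s - funQ lam s a y • funA' s‖ +
      ∫ t in intervals a, ‖lam‖ * ‖φ t‖ := by
    intro z
    rw [hφ z]
    refine (norm_add_le _ _).trans (add_le_add
      ((funP lam s a y • funA s - funQ lam s a y • funA' s).norm_coe_le_norm z) ?_)
    refine norm_integral_le_of_norm_le (integrableOn_intervals (hφc.norm.const_mul ‖lam‖) a)
      (Eventually.of_forall fun t => ?_)
    rw [norm_mul, norm_mul, Complex.norm_real]
    exact mul_le_mul_of_nonneg_right
      (mul_le_of_le_one_right (norm_nonneg _) (abs_sineKernel_le_one z t)) (norm_nonneg _)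
  let Φ : ℝ →ᵇ ℂ := BoundedContinuousFunction.ofNormedAddCommGroup φ hφc _ hb
  have hΦ : Φ - sineOp lam a Φ = funP lam s a y • funA s - funQ lam s a y • funA' s := by
    ext z
    rw [BoundedContinuousFunction.sub_apply, sineOp_apply_eq_setIntegral]
    exact sub_eq_iff_eq_add.2 (hφ z)
  have h := congrArg (fun f : ℝ →ᵇ ℂ => f x) (invOp_eq_of_sub_sineOp_eq hu hΦ)
  simp only [map_sub, map_smul, BoundedContinuousFunction.sub_apply,
    BoundedContinuousFunction.coe_smul, smul_eq_mul] at h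
  refine Eq.trans h.symm ?_
  simp only [funP, funQ]
  ring

theorem hasDerivAt_cos_pi : HasDerivAt (fun h : ℝ => ((Real.cos (Real.pi * h) : ℝ) : ℂ)) 0 0 := by
  have h := ((hasDerivAt_id (0 : ℝ)).const_mul Real.pi).cos.ofReal_comp
  simpa using h

theorem hasDerivAt_sin_pi :
    HasDerivAt (fun h : ℝ => ((Real.sin (Real.pi * h) : ℝ) : ℂ)) Real.pi 0 := by
  have h := ((hasDerivAt_id (0 : ℝ)).const_mul Real.pi).sin.ofReal_comp
  simpa using h

/-- The addition formulas. Differentiated at h = 0, they produce the P in the derivative of Q and,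
in `translate_funA'`, the -π² Q in the derivative of P. -/
theorem translate_funA (s : ℂ) (h : ℝ) : translate h (funA s) =
    ((Real.cos (Real.pi * h) : ℝ) : ℂ) • funA s +
      (((Real.sin (Real.pi * h) : ℝ) : ℂ) / Real.pi) • funA' s := by
  ext x
  simp only [translate_apply, BoundedContinuousFunction.add_apply,
    BoundedContinuousFunction.coe_smul, smul_eq_mul, funA_apply, funA'_apply, mul_add,
    Real.sin_add]
  push_cast
  ring

theorem translate_funA' (s : ℂ) (h : ℝ) : translate h (funA' s) =
    ((Real.cos (Real.pi * h) : ℝ) : ℂ) • funA' s +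
      (-Real.pi * ((Real.sin (Real.pi * h) : ℝ) : ℂ)) • funA s := by
  ext x
  have hpi : (Real.pi : ℂ) ≠ 0 := Complex.ofReal_ne_zero.2 Real.pi_ne_zero
  simp only [translate_apply, BoundedContinuousFunction.add_apply,
    BoundedContinuousFunction.coe_smul, smul_eq_mul, funA_apply, funA'_apply, mul_add,
    Real.cos_add]
  push_cast
  field_simp
  ring

section along

variable {b : ℝ → Fin (2 * m) → ℝ} {v : Fin (2 * m) → ℝ} {x : ℝ}

theorem hasDerivAt_funQ_along (ha : Admissible a) (hu : IsUnit (1 - sineOp lam a))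
    (hb : HasDerivAt b v x) (hbx : b x = a) :
    HasDerivAt (fun t => funQ lam s (b t) t) (funP lam s a x +
      ∑ j, (v j - 1) * (sgn j * resolvent lam a x (a j) * funQ lam s a (a j))) x := by
  have hpi : (Real.pi : ℂ) ≠ 0 := Complex.ofReal_ne_zero.2 Real.pi_ne_zero
  have h := hasDerivAt_invOp_along ha hu (by simp) hasDerivAt_cos_pi (by simp)
    (hasDerivAt_sin_pi.div_const (Real.pi : ℂ)) (translate_funA s) hb hbx
  rwa [div_self hpi, one_mul] at h

theorem hasDerivAt_funP_along (ha : Admissible a) (hu : IsUnit (1 - sineOp lam a))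
    (hb : HasDerivAt b v x) (hbx : b x = a) :
    HasDerivAt (fun t => funP lam s (b t) t) (-(Real.pi : ℂ) ^ 2 * funQ lam s a x +
      ∑ j, (v j - 1) * (sgn j * resolvent lam a x (a j) * funP lam s a (a j))) x := by
  have h := hasDerivAt_invOp_along ha hu (by simp) hasDerivAt_cos_pi (by simp)
    (hasDerivAt_sin_pi.const_mul (-Real.pi : ℂ)) (translate_funA' s) hb hbx
  rwa [show -(Real.pi : ℂ) * Real.pi = -(Real.pi : ℂ) ^ 2 by ring] at h

end along

/-- Continuity of φ is enough because the other factor vanishes at x. Applied to (t - x)R(t, x), it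
recovers R(x, x) without differentiating R. -/
theorem hasDerivAt_sub_mul {φ : ℝ → ℂ} {x : ℝ} (hφ : ContinuousAt φ x) :
    HasDerivAt (fun t : ℝ => ((t : ℂ) - x) * φ t) (φ x) x := by
  rw [hasDerivAt_iff_tendsto_slope]
  refine (hφ.tendsto.mono_left nhdsWithin_le_nhds).congr' ?_
  filter_upwards [self_mem_nhdsWithin] with t ht
  have h : (t : ℂ) - x ≠ 0 := by exact_mod_cast sub_ne_zero.2 ht
  rw [slope_def_module, sub_self, zero_mul, sub_zero, Complex.real_smul]
  push_cast
  rw [inv_mul_cancel_left₀ h]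

/-- The resolvent on the diagonal. -/
theorem resolvent_self (hs : s ^ 2 = lam) (ha : Admissible a) (hD : fredholmDet lam a ≠ 0)
    (x : ℝ) : resolvent lam a x x = (Real.pi : ℂ) ^ 2 * funQ lam s a x ^ 2 + funP lam s a x ^ 2 +
      ∑ k, sgn k * resolvent lam a x (a k) *
        (((x : ℂ) - a k) * resolvent lam a x (a k)) := by
  have hu := isUnit_one_sub_sineOp hD
  have hc : ContinuousAt (fun t => resolvent lam a t x) x :=
    ((continuous_resolvent hD).comp (by fun_prop : Continuous fun t : ℝ => (t, x))).continuousAt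
  have h1 := hasDerivAt_sub_mul hc
  -- Fixed endpoints: with v = 0 the formulas along a curve become the derivatives of Q and P in x
  -- alone.
  have hb : HasDerivAt (fun _ : ℝ => a) 0 x := hasDerivAt_const x a
  have hQ := hasDerivAt_funQ_along (s := s) ha hu hb rfl
  have hP := hasDerivAt_funP_along (s := s) ha hu hb rfl
  have h2 := (hQ.mul_const (funP lam s a x)).sub (hP.mul_const (funQ lam s a x))
  have h3 : (fun t : ℝ => ((t : ℂ) - x) * resolvent lam a t x) =
      (fun t => funQ lam s a t * funP lam s a x) - fun t => funP lam s a t * funQ lam s a x :=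
    funext fun t => sub_mul_resolvent hs hD t x
  rw [h3] at h1
  rw [h1.unique h2]
  simp only [sub_mul_resolvent hs hD, Pi.zero_apply, Complex.ofReal_zero, zero_sub, neg_mul,
    one_mul, Finset.sum_neg_distrib, mul_sub, Finset.sum_sub_distrib]
  simp only [add_mul, neg_mul, Finset.sum_mul]
  have e1 : ∀ k, sgn k * resolvent lam a x (a k) * funQ lam s a (a k) * funP lam s a x =
      sgn k * resolvent lam a x (a k) * (funP lam s a x * funQ lam s a (a k)) := fun k => by ring
  have e2 : ∀ k, sgn k * resolvent lam a x (a k) * funP lam s a (a k) * funQ lam s a x =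
      sgn k * resolvent lam a x (a k) * (funQ lam s a x * funP lam s a (a k)) := fun k => by ring
  simp only [e1, e2]
  ring

section boundaryValues

theorem tendsto_funQ (lam s : ℂ) (a : Fin (2 * m) → ℝ) (j : Fin (2 * m)) :
    Tendsto (fun x => funQ lam s a x) (𝓝[intervals a] (a j)) (𝓝 (funQ lam s a (a j))) :=
  ((funQ lam s a).continuous.tendsto _).mono_left nhdsWithin_le_nhds

theorem tendsto_funP (lam s : ℂ) (a : Fin (2 * m) → ℝ) (j : Fin (2 * m)) :
    Tendsto (fun x => funP lam s a x) (𝓝[intervals a] (a j)) (𝓝 (funP lam s a (a j))) :=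
  ((funP lam s a).continuous.tendsto _).mono_left nhdsWithin_le_nhds

/-- The limit has to be taken with y in I: there `resolventKernel` agrees with the continuous
function `resolvent`, while its columns at points outside I vanish. -/
theorem tendsto_resolventKernel (hD : fredholmDet lam a ≠ 0) (j k : Fin (2 * m)) :
    Tendsto (fun z : ℝ × ℝ => resolventKernel lam a z.1 z.2)
      (𝓝[intervals a] (a j) ×ˢ 𝓝[intervals a] (a k)) (𝓝 (resolvent lam a (a j) (a k))) := by
  have h : Tendsto (fun z : ℝ × ℝ => resolvent lam a z.1 z.2)
      (𝓝[intervals a] (a j) ×ˢ 𝓝[intervals a] (a k)) (𝓝 (resolvent lam a (a j) (a k))) := by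
    refine ((continuous_resolvent hD).tendsto (a j, a k)).mono_left ?_
    rw [nhds_prod_eq]
    exact Filter.prod_mono nhdsWithin_le_nhds nhdsWithin_le_nhds
  refine h.congr' ?_
  have hk : ∀ᶠ y in 𝓝[intervals a] (a k), y ∈ intervals a := self_mem_nhdsWithin
  exact (hk.prod_inr _).mono fun z hz => (resolventKernel_of_mem hz z.1).symm

theorem Admissible.qAt_eq (ha : Admissible a) (lam s : ℂ) (j : Fin (2 * m)) :
    qAt lam s a j = funQ lam s a (a j) :=
  have := ha.neBot j
  (tendsto_funQ lam s a j).limUnder_eq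

theorem Admissible.pAt_eq (ha : Admissible a) (lam s : ℂ) (j : Fin (2 * m)) :
    pAt lam s a j = funP lam s a (a j) :=
  have := ha.neBot j
  (tendsto_funP lam s a j).limUnder_eq

theorem Admissible.rAt_eq (ha : Admissible a) (hD : fredholmDet lam a ≠ 0) (j k : Fin (2 * m)) :
    rAt lam a j k = resolvent lam a (a j) (a k) :=
  have := ha.neBot j
  have := ha.neBot k
  (tendsto_resolventKernel hD j k).limUnder_eq

end boundaryValues

theorem Admissible.eventually_update (ha : Admissible a) (k : Fin (2 * m)) :
    ∀ᶠ t in 𝓝 (a k), Admissible (Function.update a k t) := by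
  have h := ha.eventually
  rw [← Function.update_eq_self k a] at h
  exact (hasDerivAt_update a k (a k)).continuousAt.eventually h

theorem hasDerivAt_invOp_update (ha : Admissible a) (hu : IsUnit (1 - sineOp lam a)) (f : ℝ →ᵇ ℂ)
    (k : Fin (2 * m)) (x : ℝ) :
    HasDerivAt (fun t => invOp lam (Function.update a k t) f x)
      (sgn k * resolvent lam a x (a k) * invOp lam a f (a k)) (a k) := by
  have h := HasFDerivAt.comp_hasDerivAt (f := fun t => Function.update a k t) (a k)
    (by rw [Function.update_eq_self]; exact hasFDerivAt_invOp_apply ha hu f x)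
    (hasDerivAt_update a k (a k))
  convert! h using 1
  rw [endpointForm_apply, Finset.sum_eq_single k]
  · simp [mul_assoc]
  · intro j _ hj
    simp [Pi.single_eq_of_ne hj]
  · simp

theorem sum_single_sub_one (j : Fin (2 * m)) (F : Fin (2 * m) → ℂ) :
    ∑ k, (((Pi.single j (1 : ℝ) : Fin (2 * m) → ℝ) k : ℂ) - 1) * F k =
      -∑ k ∈ Finset.univ.erase j, F k := by
  rw [← Finset.add_sum_erase _ _ (Finset.mem_univ j), ← Finset.sum_neg_distrib]
  simp only [Pi.single_eq_same, Complex.ofReal_one, sub_self, zero_mul, zero_add]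
  refine Finset.sum_congr rfl fun k hk => ?_
  rw [Pi.single_eq_of_ne (Finset.ne_of_mem_erase hk)]
  simp

theorem omegaForm_eq (ha : Admissible a) (hD : fredholmDet lam a ≠ 0) :
    omegaForm lam a = (fredholmDet lam a)⁻¹ •
      (-endpointForm fun j => lam * weightedMinor (weight lam a) (a j) (a j)) := by
  ext v
  simp only [omegaForm, endpointForm, neg_apply, smul_apply, sum_apply, smul_neg,
    ContinuousLinearMap.smulRight_apply, smul_eq_mul, Finset.mul_sum, ha.rAt_eq hD,
    resolvent_eq hD, Complex.real_smul]
  congr 1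
  refine Finset.sum_congr rfl fun j _ => ?_
  ring

/-- Near a point where the Fredholm determinant does not vanish it has a differentiable logarithm,
whose differential is the 1-form `omegaForm`. -/
theorem exists_log_fredholmDet (ha : Admissible a) (hD : fredholmDet lam a ≠ 0) :
    ∃ logDet : (Fin (2 * m) → ℝ) → ℂ, ∀ᶠ b in 𝓝 a,
      Complex.exp (logDet b) = fredholmDet lam b ∧ HasFDerivAt logDet (omegaForm lam b) b := by
  -- The quotient D(b)/D(a) is near 1 and so avoids the branch cut, wherever D(a) lies.
  refine ⟨fun b => Complex.log ((fredholmDet lam a)⁻¹ * fredholmDet lam b) +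
    Complex.log (fredholmDet lam a), ?_⟩
  have hc : ContinuousAt (fun b : Fin (2 * m) → ℝ => (fredholmDet lam a)⁻¹ * fredholmDet lam b) a :=
    (ha.hasFDerivAt_fredholmDet lam).continuousAt.const_mul _
  have hslit : ∀ᶠ b : Fin (2 * m) → ℝ in 𝓝 a,
      (fredholmDet lam a)⁻¹ * fredholmDet lam b ∈ Complex.slitPlane := by
    refine hc.eventually (Complex.isOpen_slitPlane.mem_nhds ?_)
    simp only [inv_mul_cancel₀ hD]
    exact Complex.one_mem_slitPlane
  filter_upwards [ha.eventually, hslit] with b hb hbs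
  have hbD : fredholmDet lam b ≠ 0 := right_ne_zero_of_mul (Complex.slitPlane_ne_zero hbs)
  constructor
  · rw [Complex.exp_add, Complex.exp_log (Complex.slitPlane_ne_zero hbs), Complex.exp_log hD]
    field_simp
  · have h0 := (hb.hasFDerivAt_fredholmDet lam).const_mul (fredholmDet lam a)⁻¹
    have h := (((Complex.hasDerivAt_log hbs).hasFDerivAt.restrictScalars ℝ).comp b h0).add_const
      (Complex.log (fredholmDet lam a))
    rw [omegaForm_eq hb hbD]
    convert! h using 1
    ext v
    simp only [smul_apply, ContinuousLinearMap.comp_apply,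
      ContinuousLinearMap.coe_restrictScalars', ContinuousLinearMap.toSpanSingleton_apply,
      smul_eq_mul]
    field_simp

end

end JMMS

end

/-! ### Assembly of the equations -/

theorem mainTheorem1 (m : ℕ) (lam s : ℂ) (hs : s ^ 2 = lam)
    (a : Fin (2 * m) → ℝ) (ha : JMMS.Admissible a) (hD : JMMS.fredholmDet lam a ≠ 0) :
    -- the objects are well defined
    IsUnit (1 - JMMS.sineOp lam a) ∧
    (∀ (f : ℝ →ᵇ ℂ) (x : ℝ),
      JMMS.invOp lam a (JMMS.sineOp lam a f) x = ∫ y, JMMS.resolventKernel lam a x y * f y) ∧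
    (∀ j, Tendsto (fun x => JMMS.funQ lam s a x) (𝓝[JMMS.intervals a] (a j))
      (𝓝 (JMMS.qAt lam s a j))) ∧
    (∀ j, Tendsto (fun x => JMMS.funP lam s a x) (𝓝[JMMS.intervals a] (a j))
      (𝓝 (JMMS.pAt lam s a j))) ∧
    (∀ j k, Tendsto (fun z : ℝ × ℝ => JMMS.resolventKernel lam a z.1 z.2)
      (𝓝[JMMS.intervals a] (a j) ×ˢ 𝓝[JMMS.intervals a] (a k)) (𝓝 (JMMS.rAt lam a j k))) ∧
    -- the resolvent off the diagonal
    (∀ j k, j ≠ k → JMMS.rAt lam a j k =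
      (JMMS.qAt lam s a j * JMMS.pAt lam s a k - JMMS.pAt lam s a j * JMMS.qAt lam s a k) /
        ((a j : ℂ) - (a k : ℂ))) ∧
    -- the derivatives with respect to the other endpoints
    (∀ j k, j ≠ k → HasDerivAt (fun t : ℝ => JMMS.qAt lam s (Function.update a k t) j)
      (JMMS.sgn k * JMMS.rAt lam a j k * JMMS.qAt lam s a k) (a k)) ∧
    (∀ j k, j ≠ k → HasDerivAt (fun t : ℝ => JMMS.pAt lam s (Function.update a k t) j)
      (JMMS.sgn k * JMMS.rAt lam a j k * JMMS.pAt lam s a k) (a k)) ∧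
    -- the resolvent on the diagonal
    (∀ j, JMMS.rAt lam a j j =
      (Real.pi : ℂ) ^ 2 * JMMS.qAt lam s a j ^ 2 + JMMS.pAt lam s a j ^ 2 +
        ∑ k, JMMS.sgn k * JMMS.rAt lam a j k * JMMS.rAt lam a k j * ((a j : ℂ) - (a k : ℂ))) ∧
    -- the derivatives with respect to the same endpoint
    (∀ j, HasDerivAt (fun t : ℝ => JMMS.qAt lam s (Function.update a j t) j)
      (JMMS.pAt lam s a j -
        ∑ k ∈ Finset.univ.erase j, JMMS.sgn k * JMMS.rAt lam a j k * JMMS.qAt lam s a k) (a j)) ∧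
    (∀ j, HasDerivAt (fun t : ℝ => JMMS.pAt lam s (Function.update a j t) j)
      (-((Real.pi : ℂ) ^ 2) * JMMS.qAt lam s a j -
        ∑ k ∈ Finset.univ.erase j, JMMS.sgn k * JMMS.rAt lam a j k * JMMS.pAt lam s a k) (a j)) ∧
    -- the exterior derivative of the logarithm of the Fredholm determinant
    (∃ logDet : (Fin (2 * m) → ℝ) → ℂ, ∀ᶠ b in 𝓝 a,
      Complex.exp (logDet b) = JMMS.fredholmDet lam b ∧
        HasFDerivAt logDet (JMMS.omegaForm lam b) b) := by
  have hu := JMMS.isUnit_one_sub_sineOp hD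
  have hup : ∀ k, (fun t => Function.update a k t) (a k) = a := fun k => Function.update_eq_self k a
  refine ⟨hu, JMMS.invOp_sineOp_apply_eq_integral lam a, fun j => ?_, fun j => ?_, fun j k => ?_,
    fun j k hjk => ?_, fun j k hjk => ?_, fun j k hjk => ?_, fun j => ?_, fun j => ?_, fun j => ?_,
    JMMS.exists_log_fredholmDet ha hD⟩
  · rw [ha.qAt_eq]
    exact JMMS.tendsto_funQ lam s a j
  · rw [ha.pAt_eq]
    exact JMMS.tendsto_funP lam s a j
  · rw [ha.rAt_eq hD]
    exact JMMS.tendsto_resolventKernel hD j k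
  · have h : (a j : ℂ) - a k ≠ 0 := by
      exact_mod_cast sub_ne_zero.2 (ha.injective.ne hjk)
    rw [ha.rAt_eq hD, ha.qAt_eq, ha.qAt_eq, ha.pAt_eq, ha.pAt_eq, eq_div_iff h, mul_comm]
    exact JMMS.sub_mul_resolvent hs hD (a j) (a k)
  · rw [ha.rAt_eq hD, ha.qAt_eq]
    -- The limit defining `qAt` is identified with a value of Q only at admissible endpoints, which
    -- suffices since these form a neighbourhood of a.
    refine (JMMS.hasDerivAt_invOp_update ha hu (JMMS.funA s) k (a j)).congr_of_eventuallyEq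
      ((ha.eventually_update k).mono fun t ht => ?_)
    simp only
    rw [ht.qAt_eq, Function.update_of_ne hjk, JMMS.funQ]
  · rw [ha.rAt_eq hD, ha.pAt_eq]
    refine (JMMS.hasDerivAt_invOp_update ha hu (JMMS.funA' s) k (a j)).congr_of_eventuallyEq
      ((ha.eventually_update k).mono fun t ht => ?_)
    simp only
    rw [ht.pAt_eq, Function.update_of_ne hjk, JMMS.funP]
  · simp only [ha.rAt_eq hD, ha.qAt_eq, ha.pAt_eq]
    rw [JMMS.resolvent_self hs ha hD]
    congr 1
    refine Finset.sum_congr rfl fun k _ => ?_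
    rw [JMMS.resolvent_comm hD (a k) (a j)]
    ring
  · simp only [ha.rAt_eq hD, ha.qAt_eq, ha.pAt_eq]
    -- Here the argument moves together with the endpoint `a j`. The velocity is the unit vector at
    -- `j`, so v_k - 1 is 0 for k = j and -1 otherwise: the singular-looking diagonal term drops out
    -- and the others acquire a minus sign.
    have h := JMMS.hasDerivAt_funQ_along (s := s) ha hu (hasDerivAt_update a j (a j)) (hup j)
    rw [JMMS.sum_single_sub_one, ← sub_eq_add_neg] at h
    refine h.congr_of_eventuallyEq ((ha.eventually_update j).mono fun t ht => ?_)
    simp only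
    rw [ht.qAt_eq, Function.update_self]
  · simp only [ha.rAt_eq hD, ha.qAt_eq, ha.pAt_eq]
    have h := JMMS.hasDerivAt_funP_along (s := s) ha hu (hasDerivAt_update a j (a j)) (hup j)
    rw [JMMS.sum_single_sub_one, ← sub_eq_add_neg] at h
    refine h.congr_of_eventuallyEq ((ha.eventually_update j).mono fun t ht => ?_)
    simp only
    rw [ht.pAt_eq, Function.update_self]
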